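/- **Definitions.** A space is *quasi-Polish* if it is homeomorphic to a subspace of $\mathbb S^{\mathbb N}$ of the form $\bigcap_{i\in\mathbb N}\bigl((\mathbb S^{\mathbb N}\setminus A_i)\cup B_i\bigr)$ with all $A_i,B_i$ open, where $\mathbb S$ is the Sierpiński space. A *topological groupoid* $G\rightrightarrows X$ consists of spaces $G$ of morphisms and $X$ of objects with continuous $\mathrm{dom},\mathrm{cod}:G\to X$, identities $x\mapsto 1_x$, inverse, and composition $gh$ (defined when $\mathrm{dom}(g)=\mathrm{cod}(h)$) satisfying the groupoid axioms; it is *open* if $\mathrm{dom},\mathrm{cod}$ are open maps, and *quasi-Polish* if $G$ and $X$ are. An *open subgroupoid* is an open $U\subseteq G$ closed under composition and inverse; $G$ is *non-Archimedean* if every $1_x$ has a neighbourhood basis in $G$ of open subgroupoids. For an open subgroupoid $U$ put $\mathrm{dom}^{-1}(U)=\{g\in G: 1_{\mathrm{dom}(g)}\in U\}$ and $G/U=\{gU: g\in\mathrm{dom}^{-1}(U)\}$ with the quotient topology; when $G$ is open, this is an étale space over $X$ (i.e. it has a local homeomorphism to $X$) via $gU\mapsto\mathrm{cod}(g)$. An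 *étale structure* $\mathcal M$ over $X$ in a multi-sorted first-order language consists of an étale space $M_s$ over $X$ for each sort $s$, a continuous map over $X$ between the corresponding fibre products over $X$ for each function symbol, and an open subset of the corresponding fibre product for each relation symbol; it is *second-countable* if each $M_s$ is. Its fibre $\mathcal M_x$ over $x\in X$ is an ordinary structure. $\mathrm{Iso}_X(\mathcal M)$ is the groupoid with objects $X$ whose morphisms are the triples $(x,y,f)$ with $f:\mathcal M_x\cong\mathcal M_y$ an isomorphism, $\mathrm{dom}(x,y,f)=x$, $\mathrm{cod}(x,y,f)=y$, with the topology generated by $\mathrm{dom}$, $\mathrm{cod}$ and the sets $\{(x,y,f): \exists a\in A\cap M_{s,x},\ f(a)\in B\}$ for $s$ a sort and $A,B\subseteq M_s$ open; it is a topological groupoid. Let $G\rightrightarrows X$ be an open non-Archimedean topological groupoid. A *choice of coset data* $(\mathcal U,(\mathcal S_U)_{U\in\mathcal U})$ is a family $\mathcal U$ of open subgroupoids such that for each $x$ the $U\in\mathcal U$ containing $1_x$ form a neighbourhood basis of $1_x$, and for each $U\in\mathcal U$ a cover $\mathcal S_U$ of $\mathrm{dom}^{-1}(U)$ by open sets $S\subseteq\mathrm{dom}^{-1}(U)$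 with $SU\subseteq S$ that correspond to open sections of $G/U$ (if $s,t\in S$ and $\mathrm{cod}(s)=\mathrm{cod}(t)$, then $sU=tU$). It is *countable* if $\mathcal U$ and all $\mathcal S_U$ are. The *canonical structure* $\mathcal M=\mathcal M_{G,\mathcal U,(\mathcal S_U)}$ is the étale structure over $X$ with a sort $G/U$ for each $U\in\mathcal U$ and a unary function $(-)S:G/U\to G/V$, $gU\mapsto gUS$, for all $U,V\in\mathcal U$ and $S\in\mathcal S_V$ with $U\subseteq SS^{-1}$. The *canonical functor* $\iota:G\to\mathrm{Iso}_X(\mathcal M)$ is the identity on objects and sends $g:x\to y$ to the isomorphism $\mathcal M_x\cong\mathcal M_y$, $C\mapsto gC$. **Theorem.** Let $G\rightrightarrows X$ be an open non-Archimedean quasi-Polish groupoid. 1. Countable coset data for $G$ exist. 2. For every countable coset data $(\mathcal U,(\mathcal S_U)_{U\in\mathcal U})$, the canonical structure $\mathcal M$ is a second-countable étale structure in a countable language, and the canonical functor $\iota:G\to\mathrm{Iso}_X(\mathcal M)$ is an isomorphism of topological groupoids (a homeomorphism on objects and on morphisms). 3. In particular, there are a second-countable étale structure $\mathcal M$ over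 $X$ in a countable multi-sorted language and an isomorphism of topological groupoids $G\cong\mathrm{Iso}_X(\mathcal M)$ that is the identity on objects. -/

import Mathlib

open Set Topology TopologicalSpace

universe u v w

namespace EtaleRep

/-! ## Quasi-Polish spaces -/

/-- A `Π⁰₂` set in the (non-Hausdorff) Borel hierarchy: a countable intersection of sets
`A i ⇒ B i = (A i)ᶜ ∪ B i` with `A i`, `B i` open. -/
def IsPi02 {Y : Type u} [TopologicalSpace Y] (P : Set Y) : Prop :=
  ∃ A B : ℕ → Set Y, (∀ i, IsOpen (A i)) ∧ (∀ i, IsOpen (B i)) ∧ P = ⋂ i, ((A i)ᶜ ∪ B i)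

/-- A quasi-Polish space: homeomorphic to a `Π⁰₂` subspace of `𝕊^ℕ`. The Sierpiński space `𝕊` is
`Prop` with the topology in which `{True}` is open and `{False}` is not. -/
def IsQuasiPolish (Y : Type u) [TopologicalSpace Y] : Prop :=
  ∃ P : Set (ℕ → Prop), IsPi02 P ∧ Nonempty (Y ≃ₜ P)

/-! ## Topological groupoids -/

/-- A topological groupoid with space of morphisms `G` and space of objects `X`.
`comp g h` is the composite `g ∘ h`, defined when `dom g = cod h`. -/
structure TopologicalGroupoid (G : Type u) (X : Type v)
    [TopologicalSpace G] [TopologicalSpace X] where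
  dom : G → X
  cod : G → X
  one : X → G
  inv : G → G
  comp : (g h : G) → dom g = cod h → G
  dom_one : ∀ x, dom (one x) = x
  cod_one : ∀ x, cod (one x) = x
  dom_inv : ∀ g, dom (inv g) = cod g
  cod_inv : ∀ g, cod (inv g) = dom g
  dom_comp : ∀ g h e, dom (comp g h e) = dom h
  cod_comp : ∀ g h e, cod (comp g h e) = cod g
  assoc : ∀ (f g h : G) (e₁ : dom f = cod g) (e₂ : dom g = cod h),
    comp (comp f g e₁) h ((dom_comp f g e₁).trans e₂) =
      comp f (comp g h e₂) (e₁.trans (cod_comp g h e₂).symm)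
  one_comp : ∀ g, comp (one (cod g)) g (dom_one _) = g
  comp_one : ∀ g, comp g (one (dom g)) (cod_one _).symm = g
  inv_comp : ∀ g, comp (inv g) g (dom_inv g) = one (dom g)
  comp_inv : ∀ g, comp g (inv g) (cod_inv g).symm = one (cod g)
  continuous_dom : Continuous dom
  continuous_cod : Continuous cod
  continuous_one : Continuous one
  continuous_inv : Continuous inv
  continuous_comp : Continuous fun p : {p : G × G // dom p.1 = cod p.2} => comp p.1.1 p.1.2 p.2

/-- A functor between topological groupoids (no continuity is required). -/
structure TopologicalGroupoid.Hom {G : Type u} {X : Type v} {H : Type*} {Y : Type*}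
    [TopologicalSpace G] [TopologicalSpace X] [TopologicalSpace H] [TopologicalSpace Y]
    (T : TopologicalGroupoid G X) (T' : TopologicalGroupoid H Y) where
  obj : X → Y
  map : G → H
  dom_map : ∀ g, T'.dom (map g) = obj (T.dom g)
  cod_map : ∀ g, T'.cod (map g) = obj (T.cod g)
  map_one : ∀ x, map (T.one x) = T'.one (obj x)
  map_comp : ∀ g h e, map (T.comp g h e) =
    T'.comp (map g) (map h) ((dom_map g).trans ((congrArg obj e).trans (cod_map h).symm))

/-- A functor is an isomorphism of topological groupoids if it is a homeomorphism on objects and on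
morphisms (so that its inverse is a continuous functor, too). -/
def TopologicalGroupoid.Hom.IsTopologicalIso {G : Type u} {X : Type v} {H : Type*} {Y : Type*}
    [TopologicalSpace G] [TopologicalSpace X] [TopologicalSpace H] [TopologicalSpace Y]
    {T : TopologicalGroupoid G X} {T' : TopologicalGroupoid H Y} (F : T.Hom T') : Prop :=
  IsHomeomorph F.obj ∧ IsHomeomorph F.map

section Groupoid

variable {G : Type u} {X : Type v} [TopologicalSpace G] [TopologicalSpace X]

/-- An open groupoid: `dom` and `cod` are open maps. -/
def TopologicalGroupoid.IsOpenGroupoid (T : TopologicalGroupoid G X) : Prop :=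
  IsOpenMap T.dom ∧ IsOpenMap T.cod

/-- An open set of morphisms that is closed under composition and inverse. -/
structure TopologicalGroupoid.OpenSubgroupoid (T : TopologicalGroupoid G X) where
  carrier : Set G
  isOpen : IsOpen carrier
  comp_mem : ∀ g h e, g ∈ carrier → h ∈ carrier → T.comp g h e ∈ carrier
  inv_mem : ∀ g, g ∈ carrier → T.inv g ∈ carrier

/-- Every identity morphism has a neighbourhood basis of open subgroupoids. -/
def TopologicalGroupoid.IsNonArchimedean (T : TopologicalGroupoid G X) : Prop :=
  ∀ x, ∀ N ∈ 𝓝 (T.one x), ∃ U : T.OpenSubgroupoid, T.one x ∈ U.carrier ∧ U.carrier ⊆ N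

namespace TopologicalGroupoid

/-- The set of all composites `a ∘ b` with `a ∈ A`, `b ∈ B`. -/
def mul (T : TopologicalGroupoid G X) (A B : Set G) : Set G :=
  {k | ∃ a ∈ A, ∃ b ∈ B, ∃ e : T.dom a = T.cod b, T.comp a b e = k}

/-- `dom⁻¹(U)`: the morphisms whose domain is an object of `U`. -/
def domPre (T : TopologicalGroupoid G X) (U : T.OpenSubgroupoid) : Set G :=
  {g | T.one (T.dom g) ∈ U.carrier}

variable (T : TopologicalGroupoid G X)

theorem mul_assoc (A B C : Set G) : T.mul (T.mul A B) C = T.mul A (T.mul B C) := by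
  ext k
  constructor
  · rintro ⟨_, ⟨a, ha, b, hb, e, rfl⟩, c, hc, e', rfl⟩
    have e'' : T.dom b = T.cod c := (T.dom_comp a b e).symm.trans e'
    exact ⟨a, ha, _, ⟨b, hb, c, hc, e'', rfl⟩, _, (T.assoc a b c e e'').symm⟩
  · rintro ⟨a, ha, _, ⟨b, hb, c, hc, e, rfl⟩, e', rfl⟩
    have e'' : T.dom a = T.cod b := e'.trans (T.cod_comp b c e)
    exact ⟨_, ⟨a, ha, b, hb, e'', rfl⟩, c, hc, _, T.assoc a b c e'' e⟩

theorem inv_comp_cancel (g h : G) (e : T.dom g = T.cod h) :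
    T.comp (T.inv g) (T.comp g h e) ((T.dom_inv g).trans (T.cod_comp g h e).symm) = h := by
  rw [← T.assoc (T.inv g) g h (T.dom_inv g) e]
  have : ∀ k (hk : k = T.one (T.dom g)) (e' : T.dom k = T.cod h), T.comp k h e' = h := by
    rintro k rfl e'
    have : ∀ x (hx : x = T.cod h) (e'' : T.dom (T.one x) = T.cod h),
        T.comp (T.one x) h e'' = h := by
      rintro x rfl e''; exact T.one_comp h
    exact this _ e _
  exact this _ (T.inv_comp g) _

theorem comp_inv_cancel (g h : G) (e : T.cod g = T.cod h) :
    T.comp g (T.comp (T.inv g) h ((T.dom_inv g).trans e))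
      ((T.cod_inv g).symm.trans (T.cod_comp _ _ _).symm) = h := by
  rw [← T.assoc g (T.inv g) h (T.cod_inv g).symm ((T.dom_inv g).trans e)]
  have : ∀ k (hk : k = T.one (T.cod g)) (e' : T.dom k = T.cod h), T.comp k h e' = h := by
    rintro k rfl e'
    have : ∀ x (hx : x = T.cod h) (e'' : T.dom (T.one x) = T.cod h),
        T.comp (T.one x) h e'' = h := by
      rintro x rfl e''; exact T.one_comp h
    exact this _ e _
  exact this _ (T.comp_inv g) _

/-- `h ∈ g U` iff `cod g = cod h` and `g⁻¹ ∘ h ∈ U`. -/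
theorem mem_singleton_mul {g h : G} {U : Set G} : h ∈ T.mul {g} U ↔
    ∃ e : T.cod g = T.cod h, T.comp (T.inv g) h ((T.dom_inv g).trans e) ∈ U := by
  constructor
  · rintro ⟨_, rfl, b, hb, e, rfl⟩
    refine ⟨(T.cod_comp _ b e).symm, ?_⟩
    rw [T.inv_comp_cancel _ b e]; exact hb
  · rintro ⟨e, h'⟩
    exact ⟨g, rfl, _, h', _, T.comp_inv_cancel g h e⟩

variable {T}

theorem self_mem_leftCoset {U : T.OpenSubgroupoid} {g : G} (hg : g ∈ T.domPre U) :
    g ∈ T.mul {g} U.carrier :=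
  ⟨g, rfl, _, hg, (T.cod_one _).symm, T.comp_one g⟩

theorem mul_self_subset (U : T.OpenSubgroupoid) : T.mul U.carrier U.carrier ⊆ U.carrier := by
  rintro _ ⟨a, ha, b, hb, e, rfl⟩
  exact U.comp_mem a b e ha hb

theorem mem_domPre_of_mem {U : T.OpenSubgroupoid} {g : G} (hg : g ∈ U.carrier) :
    g ∈ T.domPre U := by
  have := U.comp_mem _ _ (T.dom_inv g) (U.inv_mem g hg) hg
  rwa [T.inv_comp] at this

theorem mul_mono {A A' B B' : Set G} (hA : A ⊆ A') (hB : B ⊆ B') :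
    T.mul A B ⊆ T.mul A' B' := by
  rintro _ ⟨a, ha, b, hb, e, rfl⟩
  exact ⟨a, hA ha, b, hB hb, e, rfl⟩

theorem leftCoset_subset {U : T.OpenSubgroupoid} {g h : G} (hh : h ∈ T.mul {g} U.carrier) :
    T.mul {h} U.carrier ⊆ T.mul {g} U.carrier := by
  calc T.mul {h} U.carrier ⊆ T.mul (T.mul {g} U.carrier) U.carrier :=
        mul_mono (singleton_subset_iff.2 hh) subset_rfl
    _ = T.mul {g} (T.mul U.carrier U.carrier) := T.mul_assoc _ _ _
    _ ⊆ _ := mul_mono subset_rfl (mul_self_subset U)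

theorem cod_of_mem_leftCoset {A : Set G} {g h : G} (hh : h ∈ T.mul {g} A) :
    T.cod h = T.cod g := ((T.mem_singleton_mul).1 hh).1.symm

theorem mem_domPre_of_mem_leftCoset {U : T.OpenSubgroupoid} {g h : G}
    (hh : h ∈ T.mul {g} U.carrier) : h ∈ T.domPre U := by
  obtain ⟨_, rfl, b, hb, e, rfl⟩ := hh
  have := mem_domPre_of_mem hb
  simpa [domPre, T.dom_comp] using this

theorem leftCoset_symm {U : T.OpenSubgroupoid} {g h : G} (hg : g ∈ T.domPre U)
    (hh : h ∈ T.mul {g} U.carrier) : g ∈ T.mul {h} U.carrier := by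
  obtain ⟨g', hg', b, hb, e, rfl⟩ := hh
  obtain rfl : g' = g := hg'
  rename' g' => g
  refine ⟨_, rfl, T.inv b, U.inv_mem b hb, (T.dom_comp _ b e).trans (T.cod_inv b).symm, ?_⟩
  rw [T.assoc _ b (T.inv b) e (T.cod_inv b).symm]
  have : ∀ k (hk : k = T.one (T.cod b)) (e' : T.dom g = T.cod k), T.comp g k e' = g := by
    rintro k rfl e'
    have : ∀ x (hx : x = T.dom g) (e'' : T.dom g = T.cod (T.one x)),
        T.comp g (T.one x) e'' = g := by
      rintro x rfl e''; exact T.comp_one g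
    exact this _ e.symm _
  exact this _ (T.comp_inv b) _

theorem leftCoset_eq {U : T.OpenSubgroupoid} {g h : G} (hg : g ∈ T.domPre U)
    (hh : h ∈ T.mul {g} U.carrier) : T.mul {h} U.carrier = T.mul {g} U.carrier :=
  (leftCoset_subset hh).antisymm (leftCoset_subset (leftCoset_symm hg hh))

/-! ### The étale space of left cosets -/

/-- The space `G/U` of left cosets `g U`, where `g ∈ dom⁻¹(U)`. -/
def Coset (T : TopologicalGroupoid G X) (U : T.OpenSubgroupoid) : Type u :=
  {C : Set G // ∃ g ∈ T.domPre U, C = T.mul {g} U.carrier}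

/-- The quotient map `dom⁻¹(U) → G/U`, `g ↦ g U`. -/
def Coset.mk (U : T.OpenSubgroupoid) (g : T.domPre U) : T.Coset U :=
  ⟨T.mul {g.1} U.carrier, g.1, g.2, rfl⟩

/-- `G/U` carries the quotient topology. -/
instance (U : T.OpenSubgroupoid) : TopologicalSpace (T.Coset U) :=
  TopologicalSpace.coinduced (Coset.mk U) inferInstance

/-- The projection `cod : G/U → X`, `g U ↦ cod g`. -/
noncomputable def Coset.cod {U : T.OpenSubgroupoid} (C : T.Coset U) : X :=
  T.cod C.2.choose

theorem Coset.cod_eq {U : T.OpenSubgroupoid} (C : T.Coset U) {h : G} (hh : h ∈ C.1) :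
    T.cod h = C.cod := by
  have := C.2.choose_spec.2
  rw [this] at hh
  exact cod_of_mem_leftCoset hh

theorem Coset.cod_mk {U : T.OpenSubgroupoid} (g : T.domPre U) :
    (Coset.mk U g).cod = T.cod g.1 :=
  ((Coset.mk U g).cod_eq (self_mem_leftCoset g.2)).symm

theorem Coset.mk_surjective (U : T.OpenSubgroupoid) : Function.Surjective (Coset.mk U) := by
  rintro ⟨_, g, hg, rfl⟩
  exact ⟨⟨g, hg⟩, rfl⟩

theorem Coset.mk_eq_of_mem {U : T.OpenSubgroupoid} (g h : T.domPre U)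
    (hh : h.1 ∈ T.mul {g.1} U.carrier) : Coset.mk U h = Coset.mk U g :=
  Subtype.ext (leftCoset_eq g.2 hh)

theorem Coset.mem_of_mk_eq {U : T.OpenSubgroupoid} (g h : T.domPre U)
    (hh : Coset.mk U h = Coset.mk U g) : h.1 ∈ T.mul {g.1} U.carrier := by
  rw [← show T.mul {h.1} U.carrier = T.mul {g.1} U.carrier from congrArg Subtype.val hh]
  exact self_mem_leftCoset h.2

theorem Coset.continuous_mk (U : T.OpenSubgroupoid) : Continuous (Coset.mk U) :=
  continuous_coinduced_rng

theorem Coset.isOpen_iff {U : T.OpenSubgroupoid} {W : Set (T.Coset U)} :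
    IsOpen W ↔ IsOpen (Coset.mk U ⁻¹' W) := isOpen_coinduced

theorem isOpen_domPre (U : T.OpenSubgroupoid) : IsOpen (T.domPre U) :=
  U.isOpen.preimage (T.continuous_one.comp T.continuous_dom)

/-- In a fibre product `A ×_X B` with `B → X` open, the projection to `A` is open. -/
theorem isOpen_fiberProd_fst {A B Z : Type*} [TopologicalSpace A] [TopologicalSpace B]
    [TopologicalSpace Z] {p : A → Z} {q : B → Z} (hp : Continuous p) (hq : IsOpenMap q)
    {W : Set {t : A × B // p t.1 = q t.2}} (hW : IsOpen W) :
    IsOpen {a | ∃ b, ∃ e : p a = q b, (⟨(a, b), e⟩ : {t : A × B // p t.1 = q t.2}) ∈ W} := by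
  obtain ⟨O, hO, rfl⟩ := isOpen_induced_iff.1 hW
  rw [isOpen_iff_mem_nhds]
  rintro a ⟨b, e, hab⟩
  obtain ⟨A₀, B₀, hA₀, hB₀, ha, hb, hsub⟩ := isOpen_prod_iff.1 hO a b hab
  have h₁ : A₀ ∩ p ⁻¹' (q '' B₀) ∈ 𝓝 a :=
    (hA₀.inter ((hq _ hB₀).preimage hp)).mem_nhds ⟨ha, b, hb, e.symm⟩
  refine Filter.mem_of_superset h₁ ?_
  rintro a' ⟨ha', b', hb', e'⟩
  exact ⟨b', e'.symm, hsub (mk_mem_prod ha' hb')⟩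

theorem continuous_inv_comp (T : TopologicalGroupoid G X) :
    Continuous fun p : {p : G × G // T.cod p.1 = T.cod p.2} =>
      T.comp (T.inv p.1.1) p.1.2 ((T.dom_inv _).trans p.2) := by
  have h : Continuous fun p : {p : G × G // T.cod p.1 = T.cod p.2} =>
      (⟨(T.inv p.1.1, p.1.2), (T.dom_inv _).trans p.2⟩ :
        {p : G × G // T.dom p.1 = T.cod p.2}) :=
    Continuous.subtype_mk
      ((T.continuous_inv.comp (continuous_fst.comp continuous_subtype_val)).prodMk
        (continuous_snd.comp continuous_subtype_val)) _
  exact T.continuous_comp.comp h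

/-- The quotient map `dom⁻¹(U) → G/U` is open. -/
theorem Coset.isOpenMap_mk (hT : T.IsOpenGroupoid) (U : T.OpenSubgroupoid) :
    IsOpenMap (Coset.mk U) := by
  intro O hO
  rw [Coset.isOpen_iff]
  have hO' : IsOpen (Subtype.val '' O : Set G) := (isOpen_domPre U).isOpenMap_subtype_val O hO
  have hW : IsOpen {p : {p : G × G // T.cod p.1 = T.cod p.2} |
      T.comp (T.inv p.1.1) p.1.2 ((T.dom_inv _).trans p.2) ∈ U.carrier ∧
        p.1.2 ∈ (Subtype.val '' O : Set G)} :=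
    (U.isOpen.preimage T.continuous_inv_comp).inter
      (hO'.preimage (continuous_snd.comp continuous_subtype_val))
  have h := (isOpen_fiberProd_fst T.continuous_cod hT.2 hW).preimage
    (continuous_subtype_val (p := fun g => g ∈ T.domPre U))
  convert h using 1
  ext g
  constructor
  · rintro ⟨o, ho, he⟩
    obtain ⟨e, he'⟩ := T.mem_singleton_mul.1 (Coset.mem_of_mk_eq g o he)
    exact ⟨o.1, e, he', o, ho, rfl⟩
  · rintro ⟨_, e, he', o, ho, rfl⟩
    exact ⟨o, ho, Coset.mk_eq_of_mem g o (T.mem_singleton_mul.2 ⟨e, he'⟩)⟩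

theorem Coset.continuous_cod (U : T.OpenSubgroupoid) :
    Continuous (Coset.cod : T.Coset U → X) := by
  refine continuous_coinduced_dom.2 ?_
  have : (Coset.cod ∘ Coset.mk U) = fun g : T.domPre U => T.cod g.1 := funext Coset.cod_mk
  rw [this]
  exact T.continuous_cod.comp continuous_subtype_val

theorem Coset.isOpenMap_cod (hT : T.IsOpenGroupoid) (U : T.OpenSubgroupoid) :
    IsOpenMap (Coset.cod : T.Coset U → X) := by
  intro W hW
  have h := hT.2 _ ((isOpen_domPre U).isOpenMap_subtype_val _ (Coset.isOpen_iff.1 hW))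
  convert h using 1
  ext x
  constructor
  · rintro ⟨C, hC, rfl⟩
    obtain ⟨g, rfl⟩ := Coset.mk_surjective U C
    exact ⟨g.1, ⟨g, hC, rfl⟩, (Coset.cod_mk g).symm⟩
  · rintro ⟨_, ⟨g, hg, rfl⟩, rfl⟩
    exact ⟨_, hg, Coset.cod_mk g⟩

/-- `cod : G/U → X` is an étale space. -/
theorem Coset.isLocalHomeomorph_cod (hT : T.IsOpenGroupoid) (U : T.OpenSubgroupoid) :
    IsLocalHomeomorph (Coset.cod : T.Coset U → X) := by
  rw [isLocalHomeomorph_iff_isOpenEmbedding_restrict]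
  intro C
  obtain ⟨g, rfl⟩ := Coset.mk_surjective U C
  obtain ⟨O, hO, hOe⟩ := isOpen_induced_iff.1 (U.isOpen.preimage T.continuous_inv_comp)
  have hg : (g.1, g.1) ∈ O := by
    have : (⟨(g.1, g.1), rfl⟩ : {p : G × G // T.cod p.1 = T.cod p.2}) ∈ Subtype.val ⁻¹' O := by
      rw [hOe]
      change T.comp (T.inv g.1) g.1 _ ∈ U.carrier
      rw [T.inv_comp]; exact g.2
    exact this
  obtain ⟨A, B, hA, hB, hgA, hgB, hAB⟩ := isOpen_prod_iff.1 hO g.1 g.1 hg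
  set N : Set (T.domPre U) := Subtype.val ⁻¹' (A ∩ B)
  have hN : IsOpen N := (hA.inter hB).preimage continuous_subtype_val
  have hM : IsOpen (Coset.mk U '' N) := Coset.isOpenMap_mk hT U N hN
  refine ⟨Coset.mk U '' N, hM.mem_nhds ⟨g, ⟨hgA, hgB⟩, rfl⟩,
    IsOpenEmbedding.of_continuous_injective_isOpenMap
      ((Coset.continuous_cod U).comp continuous_subtype_val) ?_
      ((Coset.isOpenMap_cod hT U).comp hM.isOpenMap_subtype_val)⟩
  rintro ⟨_, a, ha, rfl⟩ ⟨_, b, hb, rfl⟩ hab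
  have e : T.cod a.1 = T.cod b.1 := by
    rw [← Coset.cod_mk a, ← Coset.cod_mk b]; exact hab
  have hmem : (⟨(a.1, b.1), e⟩ : {p : G × G // T.cod p.1 = T.cod p.2}) ∈ Subtype.val ⁻¹' O :=
    hAB (mk_mem_prod ha.1 hb.2)
  rw [hOe] at hmem
  exact Subtype.ext (Coset.mk_eq_of_mem a b (T.mem_singleton_mul.2 ⟨e, hmem⟩)).symm

end TopologicalGroupoid

end Groupoid

/-! ## Multi-sorted étale structures and their isomorphism groupoids -/

/-- A multi-sorted first-order language. -/
structure MultiSortedLanguage : Type (u + 1) where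
  Srt : Type u
  Fn : Type u
  Rel : Type u
  fnArity : Fn → ℕ
  fnDom : (f : Fn) → Fin (fnArity f) → Srt
  fnCod : Fn → Srt
  relArity : Rel → ℕ
  relDom : (R : Rel) → Fin (relArity R) → Srt

/-- Countably many sorts, function symbols and relation symbols. -/
def MultiSortedLanguage.IsCountable (L : MultiSortedLanguage.{u}) : Prop :=
  Countable L.Srt ∧ Countable L.Fn ∧ Countable L.Rel

/-- The fibre product over `X` of finitely many spaces `p i : A i → X`, with the base point recorded
(so that the empty fibre product is `X`), as a subspace of `X × ∏ i, A i`. -/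
abbrev FiberProd {X : Type v} {n : ℕ} {A : Fin n → Type w} (p : ∀ i, A i → X) :
    Type (max v w) :=
  {t : X × (∀ i, A i) // ∀ i, p i (t.2 i) = t.1}

/-- An étale `L`-structure over `X`: each sort is an étale space over `X`, each function symbol is a
continuous map over `X`, each relation symbol is an open set. -/
structure EtaleStructure (L : MultiSortedLanguage.{u}) (X : Type v) [TopologicalSpace X] where
  carrier : L.Srt → Type w
  top : ∀ s, TopologicalSpace (carrier s)
  proj : ∀ s, carrier s → X
  isLocalHomeomorph_proj : ∀ s, IsLocalHomeomorph (proj s)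
  fn : ∀ f, FiberProd (fun i => proj (L.fnDom f i)) → carrier (L.fnCod f)
  proj_fn : ∀ f t, proj (L.fnCod f) (fn f t) = t.1.1
  continuous_fn : ∀ f, Continuous (fn f)
  rel : ∀ R, Set (FiberProd (fun i => proj (L.relDom R i)))
  isOpen_rel : ∀ R, IsOpen (rel R)

attribute [instance] EtaleStructure.top

namespace EtaleStructure

variable {L : MultiSortedLanguage.{u}} {X : Type v} [TopologicalSpace X]

/-- Each sort is a second-countable space. -/
def IsSecondCountable (M : EtaleStructure.{u, v, w} L X) : Prop :=
  ∀ s, SecondCountableTopology (M.carrier s)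

/-- The fibre over `x` of the sort `s`. -/
abbrev Fiber (M : EtaleStructure.{u, v, w} L X) (s : L.Srt) (x : X) : Type w :=
  {a : M.carrier s // M.proj s a = x}

/-- The function `f` of the ordinary structure on the fibre over `x`. -/
def fiberFn (M : EtaleStructure.{u, v, w} L X) (f : L.Fn) (x : X)
    (t : ∀ i, M.Fiber (L.fnDom f i) x) : M.Fiber (L.fnCod f) x :=
  ⟨M.fn f ⟨(x, fun i => (t i).1), fun i => (t i).2⟩, M.proj_fn f _⟩

/-- The relation `R` of the ordinary structure on the fibre over `x`. -/
def fiberRel (M : EtaleStructure.{u, v, w} L X) (R : L.Rel) (x : X)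
    (t : ∀ i, M.Fiber (L.relDom R i) x) : Prop :=
  (⟨(x, fun i => (t i).1), fun i => (t i).2⟩ :
    FiberProd (fun i => M.proj (L.relDom R i))) ∈ M.rel R

/-- An isomorphism from the structure on the fibre over `x` to that on the fibre over `y`. -/
@[ext] structure Iso (M : EtaleStructure.{u, v, w} L X) (x y : X) where
  toEquiv : ∀ s, M.Fiber s x ≃ M.Fiber s y
  map_fn : ∀ f t, toEquiv (L.fnCod f) (M.fiberFn f x t) =
    M.fiberFn f y fun i => toEquiv (L.fnDom f i) (t i)
  map_rel : ∀ R t, M.fiberRel R x t ↔ M.fiberRel R y fun i => toEquiv (L.relDom R i) (t i)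

/-- An equality of base points, as an isomorphism (the identity). -/
def Iso.ofEq (M : EtaleStructure.{u, v, w} L X) {x y : X} (h : x = y) : M.Iso x y where
  toEquiv s := ⟨fun a => ⟨a.1, a.2.trans h⟩, fun a => ⟨a.1, a.2.trans h.symm⟩,
    fun _ => rfl, fun _ => rfl⟩
  map_fn := by subst h; intros; rfl
  map_rel := by subst h; intros; rfl

/-- The inverse isomorphism. -/
def Iso.symm {M : EtaleStructure.{u, v, w} L X} {x y : X} (f : M.Iso x y) : M.Iso y x where
  toEquiv s := (f.toEquiv s).symm
  map_fn k t := by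
    rw [Equiv.symm_apply_eq, f.map_fn]
    simp
  map_rel R t := by
    rw [f.map_rel]
    simp

/-- First `f`, then `g`. -/
def Iso.trans {M : EtaleStructure.{u, v, w} L X} {x y z : X} (f : M.Iso x y) (g : M.Iso y z) :
    M.Iso x z where
  toEquiv s := (f.toEquiv s).trans (g.toEquiv s)
  map_fn k t := by simp [f.map_fn, g.map_fn]
  map_rel R t := by rw [f.map_rel, g.map_rel]; rfl

/-- The set of all triples `(x, y, g)` with `g` an isomorphism from the fibre over `x` to the fibre
over `y`. -/
structure IsoSpace (M : EtaleStructure.{u, v, w} L X) where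
  dom : X
  cod : X
  iso : M.Iso dom cod

/-- The set `⟦A ↦ B⟧` of all isomorphisms that send some point of `A` to a point of `B`. -/
def IsoSpace.sends {M : EtaleStructure.{u, v, w} L X} (s : L.Srt) (A B : Set (M.carrier s)) :
    Set M.IsoSpace :=
  {g | ∃ a : M.Fiber s g.dom, a.1 ∈ A ∧ (g.iso.toEquiv s a).1 ∈ B}

/-- The topology generated by the two projections to `X` and the sets `⟦A ↦ B⟧`, where `A`, `B` are
open subsets of the same sort. -/
instance (M : EtaleStructure.{u, v, w} L X) : TopologicalSpace M.IsoSpace :=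
  TopologicalSpace.generateFrom
    ({O | ∃ W : Set X, IsOpen W ∧ (O = IsoSpace.dom ⁻¹' W ∨ O = IsoSpace.cod ⁻¹' W)} ∪
      {O | ∃ (s : L.Srt) (A B : Set (M.carrier s)), IsOpen A ∧ IsOpen B ∧
        O = IsoSpace.sends s A B})

theorem IsoSpace.ext' {M : EtaleStructure.{u, v, w} L X} {f g : M.IsoSpace}
    (h₁ : f.dom = g.dom) (h₂ : f.cod = g.cod)
    (h : ∀ s (a : M.Fiber s f.dom) (b : M.Fiber s g.dom), a.1 = b.1 →
      (f.iso.toEquiv s a).1 = (g.iso.toEquiv s b).1) : f = g := by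
  obtain ⟨x, y, f⟩ := f
  obtain ⟨x', y', g⟩ := g
  dsimp only at h₁ h₂ h
  subst h₁ h₂
  congr 1
  ext s a
  exact h s a a rfl

theorem IsoSpace.continuous_dom (M : EtaleStructure.{u, v, w} L X) :
    Continuous (IsoSpace.dom : M.IsoSpace → X) :=
  continuous_def.2 fun W hW => .basic _ (Or.inl ⟨W, hW, Or.inl rfl⟩)

theorem IsoSpace.continuous_cod (M : EtaleStructure.{u, v, w} L X) :
    Continuous (IsoSpace.cod : M.IsoSpace → X) :=
  continuous_def.2 fun W hW => .basic _ (Or.inl ⟨W, hW, Or.inr rfl⟩)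

theorem IsoSpace.isOpen_sends {M : EtaleStructure.{u, v, w} L X} {s : L.Srt}
    {A B : Set (M.carrier s)} (hA : IsOpen A) (hB : IsOpen B) : IsOpen (IsoSpace.sends s A B) :=
  .basic _ (Or.inr ⟨s, A, B, hA, hB, rfl⟩)

/-- The isomorphism groupoid of an étale structure. -/
def isoGroupoid (M : EtaleStructure.{u, v, w} L X) : TopologicalGroupoid M.IsoSpace X where
  dom := IsoSpace.dom
  cod := IsoSpace.cod
  one x := ⟨x, x, Iso.ofEq M rfl⟩
  inv g := ⟨g.cod, g.dom, g.iso.symm⟩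
  comp g h e := ⟨h.dom, g.cod, (h.iso.trans (Iso.ofEq M e.symm)).trans g.iso⟩
  dom_one _ := rfl
  cod_one _ := rfl
  dom_inv _ := rfl
  cod_inv _ := rfl
  dom_comp _ _ _ := rfl
  cod_comp _ _ _ := rfl
  assoc _ _ _ _ _ := rfl
  one_comp _ := rfl
  comp_one _ := rfl
  inv_comp g := by
    refine IsoSpace.ext' rfl rfl fun s a b hab => ?_
    obtain rfl : a = b := Subtype.ext hab
    exact congrArg Subtype.val ((g.iso.toEquiv s).symm_apply_apply a)
  comp_inv g := by
    refine IsoSpace.ext' rfl rfl fun s a b hab => ?_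
    obtain rfl : a = b := Subtype.ext hab
    exact congrArg Subtype.val ((g.iso.toEquiv s).apply_symm_apply a)
  continuous_dom := IsoSpace.continuous_dom M
  continuous_cod := IsoSpace.continuous_cod M
  continuous_one := by
    refine continuous_generateFrom_iff.2 ?_
    rintro O (⟨W, hW, rfl | rfl⟩ | ⟨s, A, B, hA, hB, rfl⟩)
    · exact hW
    · exact hW
    · convert (M.isLocalHomeomorph_proj s).isOpenMap _ (hA.inter hB) using 1
      ext x
      constructor
      · rintro ⟨a, ha, hb⟩
        exact ⟨a.1, ⟨ha, hb⟩, a.2⟩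
      · rintro ⟨a, ⟨ha, hb⟩, hx⟩
        exact ⟨⟨a, hx⟩, ha, hb⟩
  continuous_inv := by
    refine continuous_generateFrom_iff.2 ?_
    rintro O (⟨W, hW, rfl | rfl⟩ | ⟨s, A, B, hA, hB, rfl⟩)
    · exact hW.preimage (IsoSpace.continuous_cod M)
    · exact hW.preimage (IsoSpace.continuous_dom M)
    · convert IsoSpace.isOpen_sends hB hA using 1
      ext g
      constructor
      · rintro ⟨a, ha, hb⟩
        refine ⟨(g.iso.toEquiv s).symm a, hb, ?_⟩
        rw [Equiv.apply_symm_apply]; exact ha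
      · rintro ⟨a, ha, hb⟩
        refine ⟨g.iso.toEquiv s a, hb, ?_⟩
        change ((g.iso.toEquiv s).symm (g.iso.toEquiv s a)).1 ∈ B
        rw [Equiv.symm_apply_apply]; exact ha
  continuous_comp := by
    refine continuous_generateFrom_iff.2 ?_
    rintro O (⟨W, hW, rfl | rfl⟩ | ⟨s, A, B, hA, hB, rfl⟩)
    · exact hW.preimage ((IsoSpace.continuous_dom M).comp
        (continuous_snd.comp continuous_subtype_val))
    · exact hW.preimage ((IsoSpace.continuous_cod M).comp
        (continuous_fst.comp continuous_subtype_val))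
    · rw [isOpen_iff_mem_nhds]
      rintro ⟨⟨g, h⟩, e⟩ ⟨a, ha, hb⟩
      dsimp only at e
      obtain ⟨N, hN, hNe⟩ := (isLocalHomeomorph_iff_isOpenEmbedding_restrict.1
        (M.isLocalHomeomorph_proj s)) (h.iso.toEquiv s a).1
      obtain ⟨D, hDN, hD, hDmem⟩ := mem_nhds_iff.1 hN
      have hO : IsOpen ((fun p : {p : M.IsoSpace × M.IsoSpace // p.1.dom = p.2.cod} => p.1.1) ⁻¹'
          IsoSpace.sends s D B ∩
          (fun p : {p : M.IsoSpace × M.IsoSpace // p.1.dom = p.2.cod} => p.1.2) ⁻¹'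
          IsoSpace.sends s A D) :=
        ((IsoSpace.isOpen_sends hD hB).preimage (continuous_fst.comp continuous_subtype_val)).inter
          ((IsoSpace.isOpen_sends hA hD).preimage (continuous_snd.comp continuous_subtype_val))
      refine Filter.mem_of_superset (hO.mem_nhds
        ⟨⟨(Iso.ofEq M e.symm).toEquiv s (h.iso.toEquiv s a), hDmem, hb⟩, a, ha, hDmem⟩) ?_
      rintro ⟨⟨g', h'⟩, e'⟩ ⟨⟨b', hb'D, hb'B⟩, a', ha'A, ha'D⟩
      dsimp only at e' b' hb'D hb'B a' ha'A ha'D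
      refine ⟨a', ha'A, ?_⟩
      have : (Iso.ofEq M e'.symm).toEquiv s (h'.iso.toEquiv s a') = b' := by
        apply Subtype.ext
        have hinj := hNe.injective (a₁ := ⟨(h'.iso.toEquiv s a').1, hDN ha'D⟩)
          (a₂ := ⟨b'.1, hDN hb'D⟩) (((h'.iso.toEquiv s a').2.trans e'.symm).trans b'.2.symm)
        exact congrArg (fun z => z.1) hinj
      change (g'.iso.toEquiv s ((Iso.ofEq M e'.symm).toEquiv s (h'.iso.toEquiv s a'))).1 ∈ B
      rw [this]; exact hb'B

end EtaleStructure

/-! ## The canonical structure of an open non-Archimedean groupoid -/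

section Canonical

variable {G : Type u} {X : Type v} [TopologicalSpace G] [TopologicalSpace X]

/-- The data that determine a canonical structure: a family `𝒰` of open subgroupoids that contains a
neighbourhood basis of each identity morphism, and for each `U ∈ 𝒰` a cover `𝒮 U` of `dom⁻¹(U)` by
open right-`U`-invariant sets `S`, each of which is the lift of an open section of `cod : G/U → X`
(by `isSection`, `cod` is injective on `S/U`). -/
structure CosetData (T : TopologicalGroupoid G X) where
  𝒰 : Set T.OpenSubgroupoid
  nhds_basis : ∀ x, ∀ N ∈ 𝓝 (T.one x), ∃ U ∈ 𝒰, T.one x ∈ U.carrier ∧ U.carrier ⊆ N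
  𝒮 : 𝒰 → Set (Set G)
  isOpen : ∀ U, ∀ S ∈ 𝒮 U, IsOpen S
  rightInvariant : ∀ U, ∀ S ∈ 𝒮 U, T.mul S U.1.carrier ⊆ S
  isSection : ∀ U, ∀ S ∈ 𝒮 U, ∀ s ∈ S, ∀ t ∈ S, T.cod s = T.cod t →
    T.mul {s} U.1.carrier = T.mul {t} U.1.carrier
  sUnion_eq : ∀ U, ⋃₀ 𝒮 U = T.domPre U.1

namespace CosetData

variable {T : TopologicalGroupoid G X} (D : CosetData T)

/-- `𝒰` and all `𝒮 U` are countable. -/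
def IsCountable : Prop := D.𝒰.Countable ∧ ∀ U, (D.𝒮 U).Countable

/-- A symbol for the right multiplication `(-)S : G/U → G/V`, one for each `U, V ∈ 𝒰` and `S ∈ 𝒮 V`
such that `U ⊆ S S⁻¹`. -/
structure RMulSymbol where
  U : D.𝒰
  V : D.𝒰
  S : Set G
  mem : S ∈ D.𝒮 V
  subset : U.1.carrier ⊆ T.mul S (T.inv '' S)

/-- The sorts are the `U ∈ 𝒰`, the function symbols are the unary right multiplications. -/
def language : MultiSortedLanguage.{u} where
  Srt := D.𝒰
  Fn := D.RMulSymbol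
  Rel := PEmpty
  fnArity _ := 1
  fnDom f _ := f.U
  fnCod f := f.V
  relArity := PEmpty.elim
  relDom R := R.elim

variable {D}

theorem RMulSymbol.subset_domPre (f : D.RMulSymbol) {s : G} (hs : s ∈ f.S) :
    s ∈ T.domPre f.V.1 := by
  rw [← D.sUnion_eq]; exact ⟨f.S, f.mem, hs⟩

theorem RMulSymbol.exists_mem (f : D.RMulSymbol) {u : G} (hu : u ∈ f.U.1.carrier) :
    ∃ s ∈ f.S, T.cod s = T.cod u := by
  obtain ⟨a, ha, _, ⟨b, hb, rfl⟩, e, rfl⟩ := f.subset hu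
  exact ⟨a, ha, (T.cod_comp _ _ _).symm⟩

theorem RMulSymbol.mul_eq (f : D.RMulSymbol) {g s : G} (hs : s ∈ f.S) (e : T.dom g = T.cod s)
    (hg : g ∈ T.domPre f.U.1) :
    T.mul (T.mul {g} f.U.1.carrier) f.S = T.mul {T.comp g s e} f.V.1.carrier := by
  have hgs : T.mul {T.comp g s e} f.V.1.carrier = T.mul {g} (T.mul {s} f.V.1.carrier) := by
    rw [← T.mul_assoc]
    congr 1
    ext k
    constructor
    · rintro rfl; exact ⟨g, rfl, s, rfl, e, rfl⟩
    · rintro ⟨_, rfl, _, rfl, e', rfl⟩; rfl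
  rw [hgs, T.mul_assoc]
  ext k
  constructor
  · rintro ⟨_, rfl, _, ⟨y, hy, t, ht, e₁, rfl⟩, e₂, rfl⟩
    refine ⟨_, rfl, _, ?_, e₂, rfl⟩
    obtain ⟨a, ha, _, ⟨b, hb, rfl⟩, e₃, rfl⟩ := f.subset hy
    have hb' : T.cod t = T.cod b :=
      e₁.symm.trans ((T.dom_comp _ _ _).trans (T.dom_inv b))
    have ht' : t ∈ T.mul {b} f.V.1.carrier := by
      rw [← D.isSection f.V f.S f.mem t ht b hb hb']
      exact TopologicalGroupoid.self_mem_leftCoset (f.subset_domPre ht)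
    have hs' : T.cod a = T.cod s := by
      rw [← e, e₂, T.cod_comp, T.cod_comp]
    rw [← D.isSection f.V f.S f.mem a ha s hs hs']
    obtain ⟨e₄, hv⟩ := T.mem_singleton_mul.1 ht'
    refine ⟨a, rfl, _, hv, e₃.trans (T.cod_comp _ _ _).symm, ?_⟩
    exact (T.assoc a (T.inv b) t e₃ ((T.dom_inv b).trans e₄)).symm
  · rintro ⟨_, rfl, t, ht, e', rfl⟩
    have htS : t ∈ f.S := D.rightInvariant f.V f.S f.mem
      (TopologicalGroupoid.mul_mono (singleton_subset_iff.2 hs) subset_rfl ht)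
    refine ⟨_, rfl, t, ⟨T.one (T.cod t), ?_, t, htS, T.dom_one _, T.one_comp t⟩, e', rfl⟩
    rw [← e']; exact hg

/-- The right multiplication map `(-)S : G/U → G/V`, `g U ↦ (g U) S`. -/
def RMulSymbol.rmul (f : D.RMulSymbol) (C : T.Coset f.U.1) : T.Coset f.V.1 :=
  ⟨T.mul C.1 f.S, by
    obtain ⟨_, g, hg, rfl⟩ := C
    obtain ⟨s, hs, e⟩ := f.exists_mem hg
    have e' : T.dom g = T.cod s := (e.trans (T.cod_one _)).symm
    refine ⟨T.comp g s e', ?_, f.mul_eq hs e' hg⟩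
    have := f.subset_domPre hs
    simpa [TopologicalGroupoid.domPre, T.dom_comp] using this⟩

theorem RMulSymbol.cod_rmul (f : D.RMulSymbol) (C : T.Coset f.U.1) :
    (f.rmul C).cod = C.cod := by
  obtain ⟨h, hh, hC⟩ := (f.rmul C).2
  have hmem : h ∈ (f.rmul C).1 := by
    rw [hC]; exact TopologicalGroupoid.self_mem_leftCoset hh
  rw [← (f.rmul C).cod_eq hmem]
  obtain ⟨a, ha, b, hb, e, rfl⟩ := hmem
  rw [T.cod_comp]
  exact C.cod_eq ha

theorem RMulSymbol.rmul_mk (f : D.RMulSymbol) (g : T.domPre f.U.1) {s : G} (hs : s ∈ f.S)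
    (e : T.dom g.1 = T.cod s) (h : T.comp g.1 s e ∈ T.domPre f.V.1) :
    f.rmul (TopologicalGroupoid.Coset.mk _ g) = TopologicalGroupoid.Coset.mk _ ⟨_, h⟩ :=
  Subtype.ext (f.mul_eq hs e g.2)

theorem RMulSymbol.continuous_rmul (hT : T.IsOpenGroupoid) (f : D.RMulSymbol) :
    Continuous f.rmul := by
  refine continuous_coinduced_dom.2 (continuous_def.2 fun W hW => ?_)
  have hW' : IsOpen (Subtype.val '' (TopologicalGroupoid.Coset.mk _ ⁻¹' W) : Set G) :=
    (TopologicalGroupoid.isOpen_domPre f.V.1).isOpenMap_subtype_val _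
      (TopologicalGroupoid.Coset.isOpen_iff.1 hW)
  have hO : IsOpen {p : {p : G × G // T.dom p.1 = T.cod p.2} |
      T.comp p.1.1 p.1.2 p.2 ∈
        (Subtype.val '' (TopologicalGroupoid.Coset.mk f.V.1 ⁻¹' W) : Set G) ∧ p.1.2 ∈ f.S} :=
    (hW'.preimage T.continuous_comp).inter
      ((D.isOpen f.V f.S f.mem).preimage (continuous_snd.comp continuous_subtype_val))
  have h := (TopologicalGroupoid.isOpen_fiberProd_fst T.continuous_dom hT.2 hO).preimage
    (continuous_subtype_val (p := fun g => g ∈ T.domPre f.U.1))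
  convert h using 1
  ext g
  constructor
  · intro hg
    obtain ⟨s, hs, e⟩ := f.exists_mem g.2
    have e' : T.dom g.1 = T.cod s := (e.trans (T.cod_one _)).symm
    have hd : T.comp g.1 s e' ∈ T.domPre f.V.1 := by
      have := f.subset_domPre hs
      simpa [TopologicalGroupoid.domPre, T.dom_comp] using this
    refine ⟨s, e', ⟨⟨_, hd⟩, ?_, rfl⟩, hs⟩
    change TopologicalGroupoid.Coset.mk _ _ ∈ W
    rw [← f.rmul_mk g hs e' hd]
    exact hg
  · rintro ⟨s, e, ⟨⟨k, hd⟩, hk, hke⟩, hs⟩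
    dsimp only at hke e
    subst hke
    change f.rmul (TopologicalGroupoid.Coset.mk _ g) ∈ W
    rw [f.rmul_mk g hs e hd]
    exact hk

variable (D)

/-- The canonical étale structure: the sort `U` is `G/U` with projection `cod`, and the symbols are
interpreted by the right multiplication maps. -/
noncomputable def canonicalStructure (hT : T.IsOpenGroupoid) :
    EtaleStructure.{u, v, u} D.language X where
  carrier U := T.Coset (Subtype.val (p := fun U => U ∈ D.𝒰) U)
  top _ := inferInstance
  proj _ := TopologicalGroupoid.Coset.cod
  isLocalHomeomorph_proj U := TopologicalGroupoid.Coset.isLocalHomeomorph_cod hT U.1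
  fn f t := RMulSymbol.rmul f (t.1.2 (0 : Fin 1))
  proj_fn f t := (RMulSymbol.cod_rmul f _).trans (t.2 (0 : Fin 1))
  continuous_fn f := (RMulSymbol.continuous_rmul hT f).comp
    ((continuous_apply (0 : Fin 1)).comp (continuous_snd.comp continuous_subtype_val))
  rel R := PEmpty.elim R
  isOpen_rel R := PEmpty.elim R

/-- Left translation `C ↦ g C` on a sort, from the fibre over `dom g` to the fibre over `cod g`. -/
def leftTranslate (g : G) (U : T.OpenSubgroupoid)
    (C : {C : T.Coset U // C.cod = T.dom g}) : {C : T.Coset U // C.cod = T.cod g} := by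
  refine ⟨⟨T.mul {g} C.1.1, ?_⟩, ?_⟩
  · obtain ⟨⟨_, h, hh, rfl⟩, hC⟩ := C
    have e : T.dom g = T.cod h :=
      ((TopologicalGroupoid.Coset.cod_eq (⟨_, h, hh, rfl⟩ : T.Coset U)
        (TopologicalGroupoid.self_mem_leftCoset hh)).trans hC).symm
    refine ⟨T.comp g h e, ?_, ?_⟩
    · have := hh
      simpa [TopologicalGroupoid.domPre, T.dom_comp] using this
    · dsimp only
      rw [← T.mul_assoc]
      congr 1
      ext k
      constructor
      · rintro ⟨_, rfl, _, rfl, e', rfl⟩; rfl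
      · rintro rfl; exact ⟨g, rfl, h, rfl, e, rfl⟩
  · generalize_proofs hp
    obtain ⟨k, hk, hkC⟩ := hp
    have hmem : k ∈ T.mul {g} C.1.1 := by
      rw [hkC]; exact TopologicalGroupoid.self_mem_leftCoset hk
    rw [← TopologicalGroupoid.Coset.cod_eq (⟨T.mul {g} C.1.1, k, hk, hkC⟩ : T.Coset U) hmem]
    exact TopologicalGroupoid.cod_of_mem_leftCoset hmem

theorem one_mul_coset {U : T.OpenSubgroupoid} (C : T.Coset U) {x : X} (h : C.cod = x) :
    T.mul {T.one x} C.1 = C.1 := by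
  subst h
  ext k
  constructor
  · rintro ⟨_, rfl, k, hk, e, rfl⟩
    have hx := C.cod_eq hk
    have : ∀ x (hx : T.cod k = x) (e : T.dom (T.one x) = T.cod k),
        T.comp (T.one x) k e = k := by
      rintro x rfl e; exact T.one_comp k
    rw [this _ hx]; exact hk
  · intro hk
    have hx := C.cod_eq hk
    refine ⟨_, rfl, k, hk, by rw [T.dom_one, hx], ?_⟩
    have : ∀ x (hx : T.cod k = x) (e : T.dom (T.one x) = T.cod k),
        T.comp (T.one x) k e = k := by
      rintro x rfl e; exact T.one_comp k
    exact this _ hx _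

theorem singleton_mul_singleton (g h : G) (e : T.dom g = T.cod h) :
    T.mul {g} {h} = {T.comp g h e} := by
  ext k
  constructor
  · rintro ⟨_, rfl, _, rfl, e', rfl⟩; rfl
  · rintro rfl; exact ⟨g, rfl, h, rfl, e, rfl⟩

/-- The action of `g` on the canonical structure, as an isomorphism of fibres. -/
noncomputable def translateIso (hT : T.IsOpenGroupoid) (g : G) :
    (D.canonicalStructure hT).Iso (T.dom g) (T.cod g) where
  toEquiv U :=
    { toFun := leftTranslate g (Subtype.val (p := fun U => U ∈ D.𝒰) U)
      invFun := fun C =>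
        let C' := leftTranslate (T.inv g) (Subtype.val (p := fun U => U ∈ D.𝒰) U)
          ⟨C.1, C.2.trans (T.dom_inv g).symm⟩
        ⟨C'.1, C'.2.trans (T.cod_inv g)⟩
      left_inv := fun C => by
        apply Subtype.ext
        apply Subtype.ext
        change T.mul {T.inv g} (T.mul {g} C.1.1) = C.1.1
        rw [← T.mul_assoc, singleton_mul_singleton _ _ (T.dom_inv g), T.inv_comp]
        exact one_mul_coset C.1 C.2
      right_inv := fun C => by
        apply Subtype.ext
        apply Subtype.ext
        change T.mul {g} (T.mul {T.inv g} C.1.1) = C.1.1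
        rw [← T.mul_assoc, singleton_mul_singleton _ _ (T.cod_inv g).symm, T.comp_inv]
        exact one_mul_coset C.1 C.2 }
  map_fn f t := by
    apply Subtype.ext
    apply Subtype.ext
    exact (T.mul_assoc _ _ _).symm
  map_rel R := PEmpty.elim R

/-- The canonical functor `ι` from `G` to the isomorphism groupoid of its canonical structure: the
identity on objects, and `g ↦ (C ↦ g C)` on morphisms. -/
noncomputable def iota (hT : T.IsOpenGroupoid) :
    T.Hom (D.canonicalStructure hT).isoGroupoid where
  obj := id
  map g := ⟨T.dom g, T.cod g, D.translateIso hT g⟩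
  dom_map _ := rfl
  cod_map _ := rfl
  map_one x := by
    refine EtaleStructure.IsoSpace.ext' (T.dom_one x) (T.cod_one x) fun U a b hab => ?_
    apply Subtype.ext
    change T.mul {T.one x} a.1.1 = b.1.1
    rw [hab]
    exact one_mul_coset b.1 b.2
  map_comp g h e := by
    refine EtaleStructure.IsoSpace.ext' (T.dom_comp g h e) (T.cod_comp g h e) fun U a b hab => ?_
    apply Subtype.ext
    change T.mul {T.comp g h e} a.1.1 = T.mul {g} (T.mul {h} b.1.1)
    rw [hab, ← T.mul_assoc, singleton_mul_singleton g h e]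

end CosetData

end Canonical

end EtaleRep

namespace EtaleRep

/-! ## Quasi-Polish spaces: embeddings, fibres, and a convergent strategy -/

section QuasiPolish

variable {Y : Type u} {X : Type v} [TopologicalSpace Y] [TopologicalSpace X]

theorem isQuasiPolish_iff_exists_isEmbedding :
    IsQuasiPolish Y ↔ ∃ e : Y → (ℕ → Prop), IsEmbedding e ∧ IsPi02 (range e) := by
  constructor
  · rintro ⟨P, hP, ⟨h⟩⟩
    refine ⟨Subtype.val ∘ h, IsEmbedding.subtypeVal.comp h.isEmbedding, ?_⟩
    rwa [range_comp, h.surjective.range_eq, image_univ, Subtype.range_coe]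
  · rintro ⟨e, he, hP⟩
    exact ⟨range e, hP, ⟨he.toHomeomorph⟩⟩

theorem IsQuasiPolish.t0Space (hY : IsQuasiPolish Y) : T0Space Y := by
  obtain ⟨e, he, -⟩ := isQuasiPolish_iff_exists_isEmbedding.1 hY
  exact he.t0Space

theorem IsQuasiPolish.secondCountableTopology (hY : IsQuasiPolish Y) :
    SecondCountableTopology Y := by
  obtain ⟨e, he, -⟩ := isQuasiPolish_iff_exists_isEmbedding.1 hY
  exact he.secondCountableTopology

theorem IsPi02.inter {P Q : Set Y} (hP : IsPi02 P) (hQ : IsPi02 Q) : IsPi02 (P ∩ Q) := by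
  obtain ⟨A, B, hA, hB, rfl⟩ := hP
  obtain ⟨A', B', hA', hB', rfl⟩ := hQ
  let φ : ℕ ≃ ℕ ⊕ ℕ := Equiv.natSumNatEquivNat.symm
  refine ⟨fun n => Sum.elim A A' (φ n), fun n => Sum.elim B B' (φ n), fun n => ?_, fun n => ?_, ?_⟩
  · change IsOpen (Sum.elim A A' (φ n))
    rcases φ n with i | i
    exacts [hA i, hA' i]
  · change IsOpen (Sum.elim B B' (φ n))
    rcases φ n with i | i
    exacts [hB i, hB' i]
  · rw [φ.surjective.iInter_comp fun s => (Sum.elim A A' s)ᶜ ∪ Sum.elim B B' s, iInter_sum]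
    rfl

theorem IsPi02.isQuasiPolish {P : Set Y} (hP : IsPi02 P) (hY : IsQuasiPolish Y) :
    IsQuasiPolish P := by
  obtain ⟨e, he, hr⟩ := isQuasiPolish_iff_exists_isEmbedding.1 hY
  obtain ⟨A, B, hA, hB, rfl⟩ := hP
  choose A' hA' hAA using fun i => he.isOpen_iff.1 (hA i)
  choose B' hB' hBB using fun i => he.isOpen_iff.1 (hB i)
  refine isQuasiPolish_iff_exists_isEmbedding.2
    ⟨e ∘ Subtype.val, he.comp IsEmbedding.subtypeVal, ?_⟩
  convert hr.inter ⟨A', B', hA', hB', rfl⟩ using 1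
  rw [range_comp, Subtype.range_coe, ← image_preimage_eq_range_inter]
  simp only [preimage_iInter, preimage_union, preimage_compl, hAA, hBB]

/-- A point of `X` is its sequence of bits, and prescribing one bit of `f y` is an open condition
(bit true) or a closed one (bit false), so the fibre is `Π⁰₂`. -/
theorem IsQuasiPolish.fiber (hY : IsQuasiPolish Y) (hX : IsQuasiPolish X) {f : Y → X}
    (hf : Continuous f) (x : X) : IsQuasiPolish {y // f y = x} := by
  classical
  obtain ⟨e, he, -⟩ := isQuasiPolish_iff_exists_isEmbedding.1 hX
  have hO : ∀ i, IsOpen {y | e (f y) i} := fun i =>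
    continuous_Prop.1 ((continuous_apply i).comp (he.continuous.comp hf))
  refine IsPi02.isQuasiPolish (P := {y | f y = x}) ⟨fun i => if e x i then univ else {y | e (f y) i},
    fun i => if e x i then {y | e (f y) i} else ∅, fun i => ?_, fun i => ?_, ?_⟩ hY
  · dsimp only; split_ifs
    exacts [isOpen_univ, hO i]
  · dsimp only; split_ifs
    exacts [hO i, isOpen_empty]
  · ext y
    change f y = x ↔ _
    rw [← he.injective.eq_iff, funext_iff, mem_iInter]
    refine forall_congr' fun i => ?_
    by_cases h : e x i <;> simp [h]

/-- The basic open set of all `p` that contain the first `m` bits of `q`. -/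
def cylinder (m : ℕ) (q : ℕ → Prop) : Set (ℕ → Prop) := {p | ∀ k < m, q k → p k}

theorem isOpen_cylinder (m : ℕ) (q : ℕ → Prop) : IsOpen (cylinder m q) := by
  have : cylinder m q = ⋂ k ∈ Iio m, {p | q k → p k} := by ext; simp [cylinder]
  rw [this]
  refine (finite_Iio m).isOpen_biInter fun k _ => ?_
  by_cases h : q k
  · simpa [h] using continuous_Prop.1 (continuous_apply (A := fun _ => Prop) k)
  · simp [h]

/-- A basic open set constrains finitely many coordinates, and only the true bits of `q` matter: an
open subset of the Sierpiński space that contains `False` is everything. -/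
theorem eventually_cylinder_subset {O : Set (ℕ → Prop)} (hO : IsOpen O) {q : ℕ → Prop}
    (hq : q ∈ O) : ∀ᶠ m in Filter.atTop, cylinder m q ⊆ O := by
  obtain ⟨I, V, hV, hsub⟩ := isOpen_pi_iff.1 hO q hq
  have hI : ∀ᶠ m in Filter.atTop, ∀ k ∈ I, k < m :=
    (Filter.eventually_all_finset I).2 fun k _ => Filter.eventually_gt_atTop k
  filter_upwards [hI] with m hm p hp
  refine hsub fun k hk => ?_
  have hVk := hV k hk
  by_cases hqk : q k
  · have : p k = q k := propext ⟨fun _ => hqk, hp k (hm k hk)⟩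
    rw [this]; exact hVk.2
  · have h0 : q k = False := eq_false hqk
    have : V k ∈ 𝓝 False := h0 ▸ hVk.1.mem_nhds hVk.2
    rw [nhds_false, Filter.mem_top] at this
    rw [this]; trivial

/-- A quasi-Polish space is a convergent strong Choquet space: there is a strategy `σ` that answers
a pointed open set with a smaller open neighbourhood of the point, so that every run of the game
that follows `σ` is a neighbourhood basis of a point. -/
theorem IsQuasiPolish.exists_strategy (hY : IsQuasiPolish Y) :
    ∃ σ : ℕ → Y → Set Y → Set Y,
      (∀ n y W, IsOpen W → y ∈ W → σ n y W ∈ 𝓝 y) ∧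
      ∀ (y : ℕ → Y) (W : ℕ → Set Y), (∀ n, IsOpen (W n)) → (∀ n, y n ∈ W n) →
        (∀ n, W (n + 1) ⊆ σ n (y n) (W n)) →
        ∃ z, (∀ n, z ∈ W n) ∧ ∀ N ∈ 𝓝 z, ∀ᶠ n in Filter.atTop, W n ⊆ N := by
  obtain ⟨e, he, A, B, hA, hB, hr⟩ := isQuasiPolish_iff_exists_isEmbedding.1 hY
  -- The answer at stage `n` is a cylinder inside `W` that also settles the first `n` implications
  -- `A i ⇒ B i` whose premise already holds at `y`.
  have key : ∀ n y W, ∃ m, IsOpen W → y ∈ W → n ≤ m ∧ e ⁻¹' cylinder m (e y) ⊆ W ∧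
      ∀ i < n, e y ∈ A i → cylinder m (e y) ⊆ B i := by
    intro n y W
    by_cases hW : IsOpen W ∧ y ∈ W
    · obtain ⟨O, hO, rfl⟩ := he.isOpen_iff.1 hW.1
      have h₁ : ∀ᶠ m in Filter.atTop, ∀ i ∈ Iio n, e y ∈ A i → cylinder m (e y) ⊆ B i := by
        refine (Filter.eventually_all_finite (finite_Iio n)).2 fun i _ => ?_
        by_cases hi : e y ∈ A i
        · have : e y ∈ ⋂ i, ((A i)ᶜ ∪ B i) := hr ▸ mem_range_self y
          have hBi := (mem_iInter.1 this i).resolve_left fun h => h hi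
          exact (eventually_cylinder_subset (hB i) hBi).mono fun _ h _ => h
        · exact Filter.Eventually.of_forall fun _ h => absurd h hi
      obtain ⟨m, hm, hm', hm''⟩ := (h₁.and ((eventually_cylinder_subset hO hW.2).and
        (Filter.eventually_ge_atTop n))).exists
      exact ⟨m, fun _ _ => ⟨hm'', preimage_mono hm', hm⟩⟩
    · exact ⟨0, fun h h' => absurd ⟨h, h'⟩ hW⟩
  choose m hm using key
  refine ⟨fun n y W => e ⁻¹' cylinder (m n y W) (e y), fun n y W _ _ =>
    ((isOpen_cylinder _ _).preimage he.continuous).mem_nhds fun _ _ h => h, ?_⟩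
  intro y W hWo hyW hW
  have hanti : Antitone W := antitone_nat_of_succ_le fun n =>
    (hW n).trans (hm n (y n) (W n) (hWo n) (hyW n)).2.1
  -- The limit has exactly those bits that hold throughout some `W n`.
  let p : ℕ → Prop := fun k => ∃ n, ∀ z ∈ W n, e z k
  have hp : ∀ n, p ∈ cylinder (m n (y n) (W n)) (e (y n)) := fun n k hk hy =>
    ⟨n + 1, fun z hz => hW n hz k hk hy⟩
  have hev : ∀ M, ∀ᶠ n in Filter.atTop, W n ⊆ e ⁻¹' cylinder M p := by
    intro M
    have : ∀ᶠ n in Filter.atTop, ∀ k ∈ Iio M, p k → ∀ z ∈ W n, e z k := by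
      refine (Filter.eventually_all_finite (finite_Iio M)).2 fun k _ => ?_
      by_cases hk : p k
      · obtain ⟨n, hn⟩ := hk
        filter_upwards [Filter.eventually_ge_atTop n] with n' hn' _ z hz
        exact hn z (hanti hn' hz)
      · exact Filter.Eventually.of_forall fun _ h => absurd h hk
    filter_upwards [this] with n hn z hz k hk hpk
    exact hn k hk hpk z hz
  have hpr : p ∈ range e := by
    rw [hr]
    -- If `p ∈ A i`, some `W n` with `n > i` lies in `A i`. Then `y n` satisfies the premise, so the
    -- cylinder played at stage `n`, which contains `p`, lies in `B i`.
    refine mem_iInter.2 fun i => ?_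
    by_cases hi : p ∈ A i
    · right
      obtain ⟨M, hM⟩ := (eventually_cylinder_subset (hA i) hi).exists
      obtain ⟨n, hn, hin⟩ := ((hev M).and (Filter.eventually_gt_atTop i)).exists
      exact (hm n (y n) (W n) (hWo n) (hyW n)).2.2 i hin (hM (hn (hyW n))) (hp n)
    · exact Or.inl hi
  obtain ⟨z, hz⟩ := hpr
  refine ⟨z, fun n => (hm n (y n) (W n) (hWo n) (hyW n)).2.1 ?_, fun N hN => ?_⟩
  · rw [mem_preimage, hz]; exact hp n
  · rw [he.nhds_eq_comap, hz] at hN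
    obtain ⟨O, hO, hON⟩ := hN
    obtain ⟨O', hO', hO'o, hpO'⟩ := mem_nhds_iff.1 hO
    obtain ⟨M, hM⟩ := (eventually_cylinder_subset hO'o hpO').exists
    filter_upwards [hev M] with n hn
    exact hn.trans ((preimage_mono (hM.trans hO')).trans hON)

end QuasiPolish

section Groupoid

variable {G : Type u} {X : Type v} [TopologicalSpace G] [TopologicalSpace X]
  {T : TopologicalGroupoid G X}

namespace TopologicalGroupoid

/-! ## Composition and cosets -/

theorem comp_mem_domPre {U : T.OpenSubgroupoid} {g h : G} (e : T.dom g = T.cod h)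
    (hh : h ∈ T.domPre U) : T.comp g h e ∈ T.domPre U := by
  simpa [domPre, T.dom_comp] using hh

theorem one_mem_domPre {U : T.OpenSubgroupoid} {x : X} (h : T.one x ∈ U.carrier) :
    T.one x ∈ T.domPre U := mem_domPre_of_mem h

theorem one_cod_mem {U : T.OpenSubgroupoid} {g : G} (hg : g ∈ U.carrier) :
    T.one (T.cod g) ∈ U.carrier := by
  have := mem_domPre_of_mem (U.inv_mem g hg)
  rwa [domPre, mem_ofPred_eq, T.dom_inv] at this

/-- Near `(g, 1)`, composition stays near `g`. -/
theorem exists_nhds_comp_subset {g : G} {O : Set G} (hO : O ∈ 𝓝 g) :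
    ∃ A, IsOpen A ∧ g ∈ A ∧ ∃ N ∈ 𝓝 (T.one (T.dom g)),
      ∀ a ∈ A, ∀ u ∈ N, ∀ e : T.dom a = T.cod u, T.comp a u e ∈ O := by
  have e₀ : T.dom g = T.cod (T.one (T.dom g)) := (T.cod_one _).symm
  have h : (fun p : {p : G × G // T.dom p.1 = T.cod p.2} => T.comp p.1.1 p.1.2 p.2) ⁻¹' O ∈
      𝓝 (⟨(g, T.one (T.dom g)), e₀⟩ : {p : G × G // T.dom p.1 = T.cod p.2}) := by
    refine T.continuous_comp.continuousAt.preimage_mem_nhds ?_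
    change O ∈ 𝓝 (T.comp g (T.one (T.dom g)) _)
    rwa [T.comp_one]
  rw [nhds_subtype_eq_comap] at h
  obtain ⟨Q, hQ, hQs⟩ := h
  obtain ⟨A, hA, N, hN, hAN⟩ := mem_nhds_prod_iff.1 hQ
  obtain ⟨A', hA's, hA'o, hA'⟩ := mem_nhds_iff.1 hA
  exact ⟨A', hA'o, hA', N, hN, fun a ha u hu e =>
    @hQs ⟨(a, u), e⟩ (hAN (mk_mem_prod (hA's ha) hu))⟩

/-- The intersection of a left coset with a fibre of `cod` is open in that fibre. -/
theorem isOpen_leftCoset_fiber (U : T.OpenSubgroupoid) {g : G} {x : X} (hg : T.cod g = x) :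
    IsOpen ((Subtype.val : {h : G // T.cod h = x} → G) ⁻¹' T.mul {g} U.carrier) := by
  have hc : Continuous fun h : {h : G // T.cod h = x} =>
      (⟨(g, h.1), hg.trans h.2.symm⟩ : {p : G × G // T.cod p.1 = T.cod p.2}) :=
    Continuous.subtype_mk (continuous_const.prodMk continuous_subtype_val) _
  convert U.isOpen.preimage (T.continuous_inv_comp.comp hc) using 1
  ext h
  rw [mem_preimage, T.mem_singleton_mul]
  exact ⟨fun ⟨_, h⟩ => h, fun h' => ⟨hg.trans h.2.symm, h'⟩⟩

/-- By continuity of composition at `(g, 1)`, shrinking the subgroupoid shrinks the coset. With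
`isOpen_leftCoset_fiber`, cosets can therefore serve as moves in the game on a fibre of `cod`. -/
theorem exists_nhds_leftCoset_fiber_subset {x : X} (g : {h : G // T.cod h = x})
    {O : Set {h : G // T.cod h = x}} (hO : O ∈ 𝓝 g) :
    ∃ N ∈ 𝓝 (T.one (T.dom g.1)), ∀ U ⊆ N, Subtype.val ⁻¹' T.mul {g.1} U ⊆ O := by
  rw [nhds_subtype_eq_comap] at hO
  obtain ⟨Q, hQ, hQO⟩ := hO
  obtain ⟨A, -, hA, N, hN, h⟩ := exists_nhds_comp_subset (T := T) hQ
  refine ⟨N, hN, fun U hU k hk => hQO ?_⟩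
  obtain ⟨_, rfl, u, hu, e, hk⟩ := hk
  rw [mem_preimage, ← hk]
  exact h _ hA u (hU hu) e

theorem secondCountableTopology_coset [SecondCountableTopology G] (hT : T.IsOpenGroupoid)
    (U : T.OpenSubgroupoid) : SecondCountableTopology (T.Coset U) :=
  IsQuotientMap.secondCountableTopology
    ⟨⟨rfl⟩, Coset.mk_surjective U⟩ (Coset.isOpenMap_mk hT U)

/-! ## Existence of countable coset data -/

/-- For each pair `B' ⊆ B` of basic open sets with a subgroupoid in between, one such subgroupoid is
chosen; countably many choices suffice. -/
theorem exists_countable_nhds_basis [SecondCountableTopology G] (hna : T.IsNonArchimedean) :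
    ∃ 𝒰 : Set T.OpenSubgroupoid, 𝒰.Countable ∧
      ∀ x, ∀ N ∈ 𝓝 (T.one x), ∃ U ∈ 𝒰, T.one x ∈ U.carrier ∧ U.carrier ⊆ N := by
  let I : Set (Set G × Set G) := {p | p ∈ countableBasis G ×ˢ countableBasis G ∧
    ∃ U : T.OpenSubgroupoid, p.1 ⊆ U.carrier ∧ U.carrier ⊆ p.2}
  have hI : I.Countable :=
    ((countable_countableBasis G).prod (countable_countableBasis G)).mono fun _ h => h.1
  have : Countable I := hI.to_subtype
  choose F hF using fun p : I => p.2.2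
  refine ⟨range F, countable_range F, fun x N hN => ?_⟩
  obtain ⟨B, hB, hxB, hBN⟩ := (isBasis_countableBasis G).mem_nhds_iff.1 hN
  obtain ⟨U, hxU, hUB⟩ := hna x B (((isBasis_countableBasis G).isOpen hB).mem_nhds hxB)
  obtain ⟨B', hB', hxB', hB'U⟩ :=
    (isBasis_countableBasis G).mem_nhds_iff.1 (U.isOpen.mem_nhds hxU)
  exact ⟨F ⟨(B', B), ⟨hB', hB⟩, U, hB'U, hUB⟩, mem_range_self _, (hF _).1 hxB',
    (hF _).2.trans hBN⟩

/-- As `G/U` is étale and second-countable, the basic open sets on which `cod` is injective cover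
it. Their lifts to `dom⁻¹(U)` are the sections. -/
theorem exists_countable_sections [SecondCountableTopology G] (hT : T.IsOpenGroupoid)
    (U : T.OpenSubgroupoid) : ∃ 𝒮 : Set (Set G), 𝒮.Countable ∧ (∀ S ∈ 𝒮, IsOpen S) ∧
      (∀ S ∈ 𝒮, T.mul S U.carrier ⊆ S) ∧
      (∀ S ∈ 𝒮, ∀ s ∈ S, ∀ t ∈ S, T.cod s = T.cod t →
        T.mul {s} U.carrier = T.mul {t} U.carrier) ∧ ⋃₀ 𝒮 = T.domPre U := by
  have := secondCountableTopology_coset hT U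
  let 𝓑 : Set (Set (T.Coset U)) := {B ∈ countableBasis (T.Coset U) | InjOn Coset.cod B}
  have h𝓑 : 𝓑.Countable := (countable_countableBasis _).mono fun _ h => h.1
  refine ⟨(fun B => Subtype.val '' (Coset.mk U ⁻¹' B)) '' 𝓑, h𝓑.image _, ?_, ?_, ?_, ?_⟩
  · rintro _ ⟨B, hB, rfl⟩
    exact (isOpen_domPre U).isOpenMap_subtype_val _
      ((isOpen_of_mem_countableBasis hB.1).preimage (Coset.continuous_mk U))
  · rintro _ ⟨B, hB, rfl⟩ _ ⟨_, ⟨s, hs, rfl⟩, u, hu, e, rfl⟩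
    have hm : T.comp s.1 u e ∈ T.mul {s.1} U.carrier := ⟨_, rfl, u, hu, e, rfl⟩
    refine ⟨⟨_, mem_domPre_of_mem_leftCoset hm⟩, ?_, rfl⟩
    rw [mem_preimage, Coset.mk_eq_of_mem s ⟨_, mem_domPre_of_mem_leftCoset hm⟩ hm]
    exact hs
  · rintro _ ⟨B, hB, rfl⟩ _ ⟨s, hs, rfl⟩ _ ⟨t, ht, rfl⟩ hst
    exact congrArg Subtype.val (hB.2 hs ht (by rw [Coset.cod_mk, Coset.cod_mk, hst]))
  · ext g
    constructor
    · rintro ⟨_, ⟨B, hB, rfl⟩, g, -, rfl⟩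
      exact g.2
    · intro hg
      obtain ⟨N, hN, hNi⟩ := isLocalHomeomorph_iff_isOpenEmbedding_restrict.1
        (Coset.isLocalHomeomorph_cod hT U) (Coset.mk U ⟨g, hg⟩)
      obtain ⟨B, hB, hgB, hBN⟩ := (isBasis_countableBasis (T.Coset U)).mem_nhds_iff.1 hN
      exact ⟨_, ⟨B, ⟨hB, (injOn_iff_injective.2 hNi.injective).mono hBN⟩, rfl⟩, ⟨g, hg⟩, hgB, rfl⟩

end TopologicalGroupoid

namespace CosetData

open TopologicalGroupoid

theorem exists_isCountable [SecondCountableTopology G] (hT : T.IsOpenGroupoid)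
    (hna : T.IsNonArchimedean) : ∃ D : CosetData T, D.IsCountable := by
  obtain ⟨𝒰, h𝒰, hb⟩ := exists_countable_nhds_basis hna
  choose 𝒮 h₁ h₂ h₃ h₄ h₅ using exists_countable_sections (T := T) hT
  exact ⟨⟨𝒰, hb, fun U => 𝒮 U.1, fun U => h₂ U.1, fun U => h₃ U.1, fun U => h₄ U.1,
    fun U => h₅ U.1⟩, h𝒰, fun U => h₁ U.1⟩

variable {D : CosetData T}

theorem IsCountable.language (hD : D.IsCountable) : D.language.IsCountable := by
  have h𝒰 : Countable D.𝒰 := hD.1.to_subtype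
  have h𝒮 : ∀ U, Countable (D.𝒮 U) := fun U => (hD.2 U).to_subtype
  refine ⟨h𝒰, ?_, inferInstanceAs (Countable PEmpty)⟩
  let φ : D.RMulSymbol → D.𝒰 × Σ V : D.𝒰, D.𝒮 V := fun f => (f.U, ⟨f.V, f.S, f.mem⟩)
  have hφ : Function.Injective φ := by
    rintro ⟨U, V, S, hS, h⟩ ⟨U', V', S', hS', h'⟩ he
    simp only [φ, Prod.mk.injEq, Sigma.mk.injEq] at he
    obtain ⟨rfl, rfl, he⟩ := he
    cases he
    rfl
  exact hφ.countable

/-! ## The canonical functor is inducing -/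

theorem leftTranslate_mk {U : T.OpenSubgroupoid} (g : G) (h : T.domPre U)
    (e : T.dom g = T.cod h.1) (p : (Coset.mk U h).cod = T.dom g) :
    (leftTranslate g U ⟨Coset.mk U h, p⟩).1 = Coset.mk U ⟨_, comp_mem_domPre e h.2⟩ := by
  apply Subtype.ext
  change T.mul {g} (T.mul {h.1} U.carrier) = T.mul {T.comp g h.1 e} U.carrier
  rw [← T.mul_assoc, singleton_mul_singleton]

variable (D)

/-- The preimage of `⟦A ↦ B⟧` consists of the `g` for which some `h` has `h U ∈ A` and `g h U ∈ B`.
It is the projection of an open set of composable pairs, and that projection is open because `cod`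
is. -/
theorem continuous_iota (hT : T.IsOpenGroupoid) : Continuous (D.iota hT).map := by
  refine continuous_generateFrom_iff.2 ?_
  rintro O (⟨W, hW, rfl | rfl⟩ | ⟨U, A, B, hA, hB, rfl⟩)
  · exact hW.preimage T.continuous_dom
  · exact hW.preimage T.continuous_cod
  · change D.𝒰 at U
    change Set (T.Coset U.1) at A B
    have hA' : IsOpen (Subtype.val '' (Coset.mk U.1 ⁻¹' A) : Set G) :=
      (isOpen_domPre U.1).isOpenMap_subtype_val _ (Coset.isOpen_iff.1 hA)
    have hB' : IsOpen (Subtype.val '' (Coset.mk U.1 ⁻¹' B) : Set G) :=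
      (isOpen_domPre U.1).isOpenMap_subtype_val _ (Coset.isOpen_iff.1 hB)
    have hW : IsOpen {p : {p : G × G // T.dom p.1 = T.cod p.2} |
        T.comp p.1.1 p.1.2 p.2 ∈ (Subtype.val '' (Coset.mk U.1 ⁻¹' B) : Set G) ∧
          p.1.2 ∈ (Subtype.val '' (Coset.mk U.1 ⁻¹' A) : Set G)} :=
      (hB'.preimage T.continuous_comp).inter
        (hA'.preimage (continuous_snd.comp continuous_subtype_val))
    convert isOpen_fiberProd_fst T.continuous_dom hT.2 hW using 1
    ext g
    constructor
    · rintro ⟨⟨C, hC⟩, hCA, hCB⟩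
      change T.Coset U.1 at C
      obtain ⟨h, rfl⟩ := Coset.mk_surjective U.1 C
      have e : T.dom g = T.cod h.1 := (hC.symm.trans (Coset.cod_mk h) :)
      refine ⟨h.1, e, ⟨⟨_, comp_mem_domPre e h.2⟩, ?_, rfl⟩, h, hCA, rfl⟩
      change Coset.mk U.1 _ ∈ B
      rw [← leftTranslate_mk g h e hC]
      exact hCB
    · rintro ⟨_, e, ⟨⟨k, hk⟩, hkB, hke⟩, h, hhA, rfl⟩
      dsimp only at hke e
      subst hke
      have hp : (Coset.mk U.1 h).cod = T.dom g := (Coset.cod_mk h).trans e.symm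
      refine ⟨⟨Coset.mk U.1 h, hp⟩, hhA, ?_⟩
      change (leftTranslate g U.1 ⟨Coset.mk U.1 h, hp⟩).1 ∈ B
      rw [leftTranslate_mk g h e]
      exact hkB

theorem isInducing_iota (hT : T.IsOpenGroupoid) : IsInducing (D.iota hT).map := by
  refine isInducing_iff_nhds.2 fun g =>
    le_antisymm ((D.continuous_iota hT).tendsto g).le_comap fun O hO => ?_
  obtain ⟨A, hA, hgA, N, hN, h⟩ := exists_nhds_comp_subset (T := T) hO
  obtain ⟨U, hU, hxU, hUN⟩ := D.nhds_basis _ N hN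
  -- The separating open set is `⟦U/U ↦ A/U⟧`: the source consists of the cosets of identities in
  -- `U`, the target of the cosets that meet `A`.
  have hC : IsOpen (Coset.mk U '' (Subtype.val ⁻¹' U.carrier)) :=
    Coset.isOpenMap_mk hT U _ (U.isOpen.preimage continuous_subtype_val)
  have hB : IsOpen (Coset.mk U '' (Subtype.val ⁻¹' A)) :=
    Coset.isOpenMap_mk hT U _ (hA.preimage continuous_subtype_val)
  have hopen := EtaleStructure.IsoSpace.isOpen_sends (M := D.canonicalStructure hT)
    (s := (⟨U, hU⟩ : D.𝒰)) hC hB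
  refine ⟨_, hopen.mem_nhds ?_, ?_⟩
  · have e : T.dom g = T.cod (T.one (T.dom g)) := (T.cod_one _).symm
    let i : T.domPre U := ⟨T.one (T.dom g), one_mem_domPre hxU⟩
    have hp : (Coset.mk U i).cod = T.dom g := (Coset.cod_mk i).trans e.symm
    refine ⟨⟨Coset.mk U i, hp⟩, ⟨i, hxU, rfl⟩, ?_⟩
    change (leftTranslate g U ⟨Coset.mk U i, hp⟩).1 ∈ Coset.mk U '' (Subtype.val ⁻¹' A)
    rw [leftTranslate_mk g i e]
    refine ⟨⟨g, hxU⟩, hgA, ?_⟩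
    congr 2
    exact (T.comp_one g).symm
  · rintro k ⟨⟨C, hCk⟩, ⟨u, hu, rfl⟩, hkB⟩
    have e : T.dom k = T.cod u.1 := (hCk.symm.trans (Coset.cod_mk u) :)
    have hp : (Coset.mk U u).cod = T.dom k := hCk
    change (leftTranslate k U ⟨Coset.mk U u, hp⟩).1 ∈ Coset.mk U '' (Subtype.val ⁻¹' A) at hkB
    rw [leftTranslate_mk k u e] at hkB
    obtain ⟨a, ha, hak⟩ := hkB
    have hk : T.one (T.dom k) ∈ U.carrier := e ▸ one_cod_mem hu
    have hku : T.comp k u.1 e ∈ T.mul {k} U.carrier := ⟨k, rfl, u.1, hu, e, rfl⟩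
    -- Since `u ∈ U`, the coset `k u U = a U` is also `k U`.
    have hka : k ∈ T.mul {a.1} U.carrier := by
      have h₁ := Coset.mk_eq_of_mem ⟨k, hk⟩ ⟨_, comp_mem_domPre e u.2⟩ hku
      exact Coset.mem_of_mk_eq a ⟨k, hk⟩ (h₁.symm.trans hak.symm)
    obtain ⟨_, rfl, b, hb, e', rfl⟩ := hka
    exact h _ ha b (hUN hb) e'

/-! ## Isomorphisms between fibres of the canonical structure -/

variable {D} {hT : T.IsOpenGroupoid} {x y : X}

/-- The fibre isomorphism `f` sends the coset `g U` to the coset `k U`. -/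
def Matches (f : (D.canonicalStructure hT).Iso x y) (U : D.𝒰) (g k : G) : Prop :=
  ∃ (hg : g ∈ T.domPre U.1) (hk : k ∈ T.domPre U.1) (ex : T.cod g = x) (ey : T.cod k = y),
    f.toEquiv U ⟨Coset.mk U.1 ⟨g, hg⟩, (Coset.cod_mk _).trans ex⟩ =
      ⟨Coset.mk U.1 ⟨k, hk⟩, (Coset.cod_mk _).trans ey⟩

namespace Matches

variable {f : (D.canonicalStructure hT).Iso x y} {U V : D.𝒰} {g k : G}

theorem symm (h : Matches f U g k) : Matches f.symm U k g := by
  obtain ⟨hg, hk, ex, ey, h⟩ := h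
  exact ⟨hk, hg, ey, ex, ((f.toEquiv U).symm_apply_eq).2 h.symm⟩

theorem exists_right (f : (D.canonicalStructure hT).Iso x y) (hg : g ∈ T.domPre U.1)
    (ex : T.cod g = x) : ∃ k, Matches f U g k := by
  have key : ∀ C : (D.canonicalStructure hT).Fiber U y, ∃ (k : G) (hk : k ∈ T.domPre U.1)
      (ey : T.cod k = y), C = ⟨Coset.mk U.1 ⟨k, hk⟩, (Coset.cod_mk _).trans ey⟩ := by
    rintro ⟨C, hC⟩
    obtain ⟨k, rfl⟩ := Coset.mk_surjective U.1 C
    exact ⟨k.1, k.2, (Coset.cod_mk k).symm.trans hC, rfl⟩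
  obtain ⟨k, hk, ey, h⟩ := key
    (f.toEquiv U ⟨Coset.mk U.1 ⟨g, hg⟩, (Coset.cod_mk _).trans ex⟩)
  exact ⟨k, hg, hk, ex, ey, h⟩

theorem congr_right (h : Matches f U g k) {k' : G} (hk' : k' ∈ T.mul {k} U.1.carrier) :
    Matches f U g k' := by
  obtain ⟨hg, hk, ex, ey, h⟩ := h
  refine ⟨hg, mem_domPre_of_mem_leftCoset hk', ex, (cod_of_mem_leftCoset hk').trans ey, ?_⟩
  rw [h]
  exact Subtype.ext
    (Coset.mk_eq_of_mem ⟨k, hk⟩ ⟨k', mem_domPre_of_mem_leftCoset hk'⟩ hk').symm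

theorem congr_left (h : Matches f U g k) {g' : G} (hg' : g' ∈ T.mul {g} U.1.carrier) :
    Matches f U g' k := (h.symm.congr_right hg').symm

theorem mem_right (h : Matches f U g k) {k' : G} (h' : Matches f U g k') :
    k' ∈ T.mul {k} U.1.carrier := by
  obtain ⟨hg, hk, ex, ey, h⟩ := h
  obtain ⟨_, hk', _, _, h'⟩ := h'
  exact Coset.mem_of_mk_eq ⟨k, hk⟩ ⟨k', hk'⟩ (congrArg Subtype.val (h'.symm.trans h))

/-- `f` commutes with `(-)S`, and `(g V) S = g s U` for any `s ∈ S` composable with `g`. The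
representatives `s` and `t` may differ, as `dom g` and `dom k` may. -/
theorem comp (h : Matches f V g k) {S : Set G} (hS : S ∈ D.𝒮 U)
    (hV : V.1.carrier ⊆ T.mul S (T.inv '' S)) {s t : G} (hs : s ∈ S) (ht : t ∈ S)
    (es : T.dom g = T.cod s) (et : T.dom k = T.cod t) :
    Matches f U (T.comp g s es) (T.comp k t et) := by
  obtain ⟨hg, hk, ex, ey, h⟩ := h
  let F : D.RMulSymbol := ⟨V, U, S, hS, hV⟩
  have hgs : T.comp g s es ∈ T.domPre U.1 := comp_mem_domPre es (F.subset_domPre hs)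
  have hkt : T.comp k t et ∈ T.domPre U.1 := comp_mem_domPre et (F.subset_domPre ht)
  refine ⟨hgs, hkt, (T.cod_comp _ _ _).trans ex, (T.cod_comp _ _ _).trans ey, ?_⟩
  have hF := f.map_fn F fun _ => ⟨Coset.mk V.1 ⟨g, hg⟩, (Coset.cod_mk _).trans ex⟩
  have h₁ : (D.canonicalStructure hT).fiberFn F x
      (fun _ => ⟨Coset.mk V.1 ⟨g, hg⟩, (Coset.cod_mk _).trans ex⟩) =
        ⟨Coset.mk U.1 ⟨_, hgs⟩, (Coset.cod_mk _).trans ((T.cod_comp _ _ _).trans ex)⟩ :=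
    Subtype.ext (F.rmul_mk ⟨g, hg⟩ hs es hgs)
  have h₂ : (D.canonicalStructure hT).fiberFn F y
      (fun _ => ⟨Coset.mk V.1 ⟨k, hk⟩, (Coset.cod_mk _).trans ey⟩) =
        ⟨Coset.mk U.1 ⟨_, hkt⟩, (Coset.cod_mk _).trans ((T.cod_comp _ _ _).trans ey)⟩ :=
    Subtype.ext (F.rmul_mk ⟨k, hk⟩ ht et hkt)
  refine (congrArg (f.toEquiv U) h₁).symm.trans (hF.trans (Eq.trans ?_ h₂))
  exact congrArg ((D.canonicalStructure hT).fiberFn F y) (funext fun _ => h)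

/-- The language has no dedicated symbol for the projection `g V ↦ g U`. A section `S` containing
`V` contains the identities at `dom g` and `dom k`, so `(-)S` acts as this projection. -/
theorem coarsen (h : Matches f V g k) {S : Set G} (hS : S ∈ D.𝒮 U) (hV : V.1.carrier ⊆ S) :
    Matches f U g k := by
  have hg := h.choose
  have hk := h.choose_spec.choose
  have hVS : V.1.carrier ⊆ T.mul S (T.inv '' S) := fun v hv =>
    ⟨v, hV hv, _, ⟨_, hV (mem_domPre_of_mem hv), rfl⟩,
      (T.dom_one _).symm.trans (T.cod_inv _).symm, by
        have h₁ : T.inv (T.one (T.dom v)) = T.one (T.dom v) := by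
          have := T.comp_one (T.inv (T.one (T.dom v)))
          have h₂ := T.inv_comp (T.one (T.dom v))
          simp only [T.dom_inv, T.dom_one, T.cod_one] at this h₂
          rw [← this, h₂]
        have : ∀ (i : G) (hi : i = T.one (T.dom v)) (e : T.dom v = T.cod i),
            T.comp v i e = v := by
          rintro i rfl e; exact T.comp_one v
        exact this _ h₁ _⟩
  have := h.comp hS hVS (hV hg) (hV hk) (T.cod_one _).symm (T.cod_one _).symm
  rwa [T.comp_one, T.comp_one] at this

/-- A match can be refined to a smaller subgroupoid, keeping the left representative. -/
theorem refine (h : Matches f U g k) {N : Set G} (hN : N ∈ 𝓝 (T.one (T.dom g))) :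
    ∃ V : D.𝒰, V.1.carrier ⊆ N ∩ U.1.carrier ∧
      ∃ k' ∈ T.mul {k} U.1.carrier, Matches f V g k' := by
  have hg := h.choose
  obtain ⟨S, hS, h1S⟩ : T.one (T.dom g) ∈ ⋃₀ D.𝒮 U := by
    rw [D.sUnion_eq]; exact one_mem_domPre hg
  -- Taking `V` inside `S` as well lets the new match coarsen back to `U`, which forces `k' ∈ k U`.
  obtain ⟨V, hV, h1V, hVN⟩ := D.nhds_basis _ _ (Filter.inter_mem
    (Filter.inter_mem hN (U.1.isOpen.mem_nhds hg)) ((D.isOpen U S hS).mem_nhds h1S))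
  obtain ⟨k', hk'⟩ := exists_right (U := ⟨V, hV⟩) f h1V h.choose_spec.choose_spec.choose
  exact ⟨⟨V, hV⟩, fun v hv => (hVN hv).1, k',
    h.mem_right (hk'.coarsen hS fun v hv => (hVN hv).2), hk'⟩

end Matches

/-- The `v` with `v t ∈ S` for some `t ∈ S` form an open subset of `S S⁻¹`, since `cod` is open; the
identity at `cod s` belongs to it via `t = s`. Hence every section admits symbols `(-)S` from
sufficiently small sorts. -/
theorem exists_subset_mul_inv (hT : T.IsOpenGroupoid) {U : D.𝒰} {S : Set G} (hS : S ∈ D.𝒮 U)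
    {s : G} (hs : s ∈ S) : T.mul S (T.inv '' S) ∈ 𝓝 (T.one (T.cod s)) := by
  have hO : IsOpen {p : {p : G × G // T.dom p.1 = T.cod p.2} |
      T.comp p.1.1 p.1.2 p.2 ∈ S ∧ p.1.2 ∈ S} :=
    ((D.isOpen U S hS).preimage T.continuous_comp).inter
      ((D.isOpen U S hS).preimage (continuous_snd.comp continuous_subtype_val))
  refine Filter.mem_of_superset ((isOpen_fiberProd_fst T.continuous_dom hT.2 hO).mem_nhds
    ⟨s, T.dom_one _, ?_, hs⟩) ?_
  · rw [T.one_comp]; exact hs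
  · rintro v ⟨t, e, hvt, ht⟩
    refine ⟨_, hvt, _, ⟨t, ht, rfl⟩, (T.dom_comp _ _ _).trans (T.cod_inv t).symm, ?_⟩
    rw [T.assoc v t (T.inv t) e (T.cod_inv t).symm]
    have : ∀ i (hi : i = T.one (T.dom v)) (e' : T.dom v = T.cod i), T.comp v i e' = v := by
      rintro i rfl e'; exact T.comp_one v
    exact this _ ((T.comp_inv t).trans (by rw [e])) _

/-- A fibre isomorphism that matches `g` and `k` at all small subgroupoids is left translation by
`k g⁻¹`. -/
theorem iota_eq_of_matches {f : (D.canonicalStructure hT).Iso x y} {g k : G}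
    (e : T.dom g = T.dom k) (h : ∀ U : D.𝒰, T.one (T.dom g) ∈ U.1.carrier → Matches f U g k)
    (ex : T.cod g = x) (ey : T.cod k = y) :
    (D.iota hT).map (T.comp k (T.inv g) (e.symm.trans (T.cod_inv g).symm)) = ⟨x, y, f⟩ := by
  have hd : T.dom (T.comp k (T.inv g) (e.symm.trans (T.cod_inv g).symm)) = x :=
    (T.dom_comp _ _ _).trans ((T.dom_inv g).trans ex)
  refine EtaleStructure.IsoSpace.ext' hd ((T.cod_comp _ _ _).trans ey) fun U a b hab => ?_
  change D.𝒰 at U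
  obtain ⟨b, hb⟩ := b
  obtain ⟨a, ha⟩ := a
  obtain rfl : a = b := hab
  obtain ⟨c, rfl⟩ := Coset.mk_surjective U.1 a
  have hc : T.cod g = T.cod c.1 := ex.trans (hb.symm.trans (Coset.cod_mk c))
  -- With `c' = g⁻¹ c` in a section `S`, the coset `c U` is `(g V) S`; hence `f` sends it to `(k V)
  -- S = k c' U`, which is `k g⁻¹ c U`.
  let c' := T.comp (T.inv g) c.1 ((T.dom_inv g).trans hc)
  have hc'd : c' ∈ T.domPre U.1 := comp_mem_domPre _ c.2
  have e₁ : T.cod c' = T.dom g := (T.cod_comp _ _ _).trans (T.cod_inv g)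
  obtain ⟨S, hS, hc'S⟩ : c' ∈ ⋃₀ D.𝒮 U := by rw [D.sUnion_eq]; exact hc'd
  have hN := exists_subset_mul_inv hT hS hc'S
  rw [e₁] at hN
  obtain ⟨V, hV, h1V, hVN⟩ := D.nhds_basis _ _ hN
  obtain ⟨h₁, h₂, _, _, hM⟩ := (h ⟨V, hV⟩ h1V).comp hS hVN hc'S hc'S e₁.symm (e.symm.trans e₁.symm)
  have hgc : T.comp g c' e₁.symm = c.1 := T.comp_inv_cancel g c.1 hc
  have hl := leftTranslate_mk (T.comp k (T.inv g) (e.symm.trans (T.cod_inv g).symm)) c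
    (hd.trans (ex.symm.trans hc)) ha
  refine hl.trans ?_
  have hcc : (⟨Coset.mk U.1 c, hb⟩ : (D.canonicalStructure hT).Fiber U x) =
      ⟨Coset.mk U.1 ⟨_, h₁⟩, (Coset.cod_mk _).trans ((T.cod_comp _ _ _).trans ex)⟩ :=
    Subtype.ext (congrArg (Coset.mk U.1) (Subtype.ext hgc.symm))
  refine Eq.trans ?_ (congrArg Subtype.val ((congrArg (f.toEquiv U) hcc).trans hM)).symm
  exact congrArg (Coset.mk U.1) (Subtype.ext (T.assoc k (T.inv g) c.1 _ _))

/-! ## Surjectivity of the canonical functor -/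

/-- Half a step of the back-and-forth construction: refine a match into a given neighbourhood of the
left representative and into finitely many given subgroupoids. -/
theorem Matches.exists_refine {f : (D.canonicalStructure hT).Iso x y} {U : D.𝒰} {g k : G}
    (h : Matches f U g k) (u : ℕ → D.𝒰) (n : ℕ) (ex : T.cod g = x)
    {Q : Set {h : G // T.cod h = x}} (hQ : Q ∈ 𝓝 ⟨g, ex⟩) :
    ∃ V : D.𝒰, V.1.carrier ⊆ U.1.carrier ∧ Subtype.val ⁻¹' T.mul {g} V.1.carrier ⊆ Q ∧
      (∀ i < n, T.one (T.dom g) ∈ (u i).1.carrier → V.1.carrier ⊆ (u i).1.carrier) ∧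
      ∃ k' ∈ T.mul {k} U.1.carrier, Matches f V g k' := by
  obtain ⟨N, hN, hNQ⟩ := exists_nhds_leftCoset_fiber_subset ⟨g, ex⟩ hQ
  have hI : (⋂ i ∈ Iio n, {v | T.one (T.dom g) ∈ (u i).1.carrier → v ∈ (u i).1.carrier}) ∈
      𝓝 (T.one (T.dom g)) := by
    refine (Filter.biInter_mem (finite_Iio n)).2 fun i _ => ?_
    by_cases hi : T.one (T.dom g) ∈ (u i).1.carrier
    · exact Filter.mem_of_superset ((u i).1.isOpen.mem_nhds hi) fun v hv _ => hv
    · exact Filter.mem_of_superset Filter.univ_mem fun v _ h' => absurd h' hi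
  obtain ⟨V, hV, k', hk', hM⟩ := h.refine (Filter.inter_mem hN hI)
  refine ⟨V, fun v hv => (hV hv).2, hNQ _ fun v hv => (hV hv).1.1, fun i hi h1 v hv => ?_,
    k', hk', hM⟩
  exact mem_iInter₂.1 (hV hv).1.2 i hi h1

/-- Back-and-forth: a state is a matched pair of cosets of one subgroupoid, and each step shrinks
both cosets into the answers of the two strategies. Bookkeeping along an enumeration `u` of `𝒰`
makes the subgroupoids small near both limit domains. -/
theorem exists_matches (hG : IsQuasiPolish G) (hX : IsQuasiPolish X) (hD : D.𝒰.Countable)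
    (f : (D.canonicalStructure hT).Iso x y) :
    ∃ g k : G, T.cod g = x ∧ T.cod k = y ∧ T.dom g = T.dom k ∧
      ∀ U : D.𝒰, T.one (T.dom g) ∈ U.1.carrier → Matches f U g k := by
  obtain ⟨σ, hσ, hσ'⟩ := (hG.fiber hX T.continuous_cod x).exists_strategy
  obtain ⟨τ, hτ, hτ'⟩ := (hG.fiber hX T.continuous_cod y).exists_strategy
  obtain ⟨U₀, hU₀, h1U₀, -⟩ := D.nhds_basis x univ Filter.univ_mem
  have : Nonempty D.𝒰 := ⟨⟨U₀, hU₀⟩⟩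
  have : Countable D.𝒰 := hD.to_subtype
  obtain ⟨u, hu⟩ := exists_surjective_nat D.𝒰
  let St := {p : D.𝒰 × {h : G // T.cod h = x} × {h : G // T.cod h = y} //
    Matches f p.1 p.2.1.1 p.2.2.1}
  let W : St → Set {h : G // T.cod h = x} := fun p =>
    Subtype.val ⁻¹' T.mul {p.1.2.1.1} p.1.1.1.carrier
  let W' : St → Set {h : G // T.cod h = y} := fun p =>
    Subtype.val ⁻¹' T.mul {p.1.2.2.1} p.1.1.1.carrier
  have hW : ∀ p, IsOpen (W p) := fun p => isOpen_leftCoset_fiber _ p.1.2.1.2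
  have hW' : ∀ p, IsOpen (W' p) := fun p => isOpen_leftCoset_fiber _ p.1.2.2.2
  have hmem : ∀ p : St, p.1.2.1 ∈ W p := fun p => self_mem_leftCoset p.2.choose
  have hmem' : ∀ p : St, p.1.2.2 ∈ W' p := fun p => self_mem_leftCoset p.2.choose_spec.choose
  have step : ∀ (n : ℕ) (p : St), ∃ q : St, q.1.1.1.carrier ⊆ p.1.1.1.carrier ∧
      W q ⊆ σ n p.1.2.1 (W p) ∧ q.1.2.2 ∈ W' p ∧ W' q ⊆ τ n q.1.2.2 (W' p) ∧
      (∀ i < n, T.one (T.dom p.1.2.1.1) ∈ (u i).1.carrier →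
        q.1.1.1.carrier ⊆ (u i).1.carrier) ∧
      ∀ i < n, T.one (T.dom q.1.2.2.1) ∈ (u i).1.carrier →
        q.1.1.1.carrier ⊆ (u i).1.carrier := by
    rintro n ⟨⟨U, ⟨g, ex⟩, ⟨k, ey⟩⟩, hM⟩
    -- The first refinement keeps `g` and moves `k` to `k'` inside `k U`; the second keeps `k'` and
    -- moves `g` to `g'` inside `g V`, so the answer to `σ` obtained first survives.
    dsimp only at hM
    obtain ⟨V, hVU, hVσ, hVu, k', hk', hM'⟩ :=
      hM.exists_refine u n ex (hσ n ⟨g, ex⟩ _ (hW ⟨⟨U, ⟨g, ex⟩, ⟨k, ey⟩⟩, hM⟩) (hmem _))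
    have ey' : T.cod k' = y := (cod_of_mem_leftCoset hk').trans ey
    obtain ⟨V', hV'V, hV'τ, hV'u, g', hg', hM''⟩ :=
      hM'.symm.exists_refine u n ey'
        (hτ n ⟨k', ey'⟩ _ (hW' ⟨⟨U, ⟨g, ex⟩, ⟨k, ey⟩⟩, hM⟩) hk')
    refine ⟨⟨⟨V', ⟨g', (cod_of_mem_leftCoset hg').trans ex⟩, ⟨k', ey'⟩⟩, hM''.symm⟩,
      hV'V.trans hVU, ?_, hk', hV'τ, fun i hi h1 => hV'V.trans (hVu i hi h1), hV'u⟩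
    refine Subset.trans (preimage_mono ?_) hVσ
    exact (mul_mono subset_rfl hV'V).trans (leftCoset_subset hg')
  choose next hnext using step
  obtain ⟨k₀, hk₀⟩ := Matches.exists_right (U := ⟨U₀, hU₀⟩) f (one_mem_domPre h1U₀) (T.cod_one x)
  let p : ℕ → St := fun n => Nat.rec
    ⟨⟨⟨U₀, hU₀⟩, ⟨T.one x, T.cod_one x⟩, ⟨k₀, hk₀.choose_spec.choose_spec.choose_spec.choose⟩⟩, hk₀⟩
    next n
  have hp : ∀ n, p (n + 1) = next n (p n) := fun _ => rfl
  obtain ⟨⟨g, ex⟩, hg, hgN⟩ := hσ' (fun n => (p n).1.2.1) (fun n => W (p n)) (fun n => hW _)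
    (fun n => hmem _) fun n => (hnext n (p n)).2.1
  -- The index is shifted: the point played in `W' (p n)` is the new representative `k'`, chosen
  -- before `τ` is consulted.
  obtain ⟨⟨k, ey⟩, hk, hkN⟩ := hτ' (fun n => (p (n + 1)).1.2.2) (fun n => W' (p n))
    (fun n => hW' _) (fun n => (hnext n (p n)).2.2.1) fun n => (hnext n (p n)).2.2.2.1
  have hM : ∀ n, Matches f (p n).1.1 g k := fun n =>
    ((p n).2.congr_left (hg n)).congr_right (hk n)
  -- Convergence puts the `n`th left representative in `g U`, so the identity at its domain lies in
  -- `U`; once `n` exceeds the index of `U`, the next subgroupoid is contained in `U`.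
  have hgU : ∀ U : D.𝒰, T.one (T.dom g) ∈ U.1.carrier →
      ∃ n, (p n).1.1.1.carrier ⊆ U.1.carrier := by
    intro U h1
    obtain ⟨i, rfl⟩ := hu U
    have hn := hgN _ ((isOpen_leftCoset_fiber (u i).1 ex).mem_nhds (self_mem_leftCoset h1))
    obtain ⟨n, hn, hin⟩ := (hn.and (Filter.eventually_gt_atTop i)).exists
    exact ⟨n + 1, (hnext n (p n)).2.2.2.2.1 i hin
      (mem_domPre_of_mem_leftCoset (hn (hmem (p n))))⟩
  have hkU : ∀ U : D.𝒰, T.one (T.dom k) ∈ U.1.carrier →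
      ∃ n, (p n).1.1.1.carrier ⊆ U.1.carrier := by
    intro U h1
    obtain ⟨i, rfl⟩ := hu U
    have hn := hkN _ ((isOpen_leftCoset_fiber (u i).1 ey).mem_nhds (self_mem_leftCoset h1))
    obtain ⟨n, hn, hin⟩ := (hn.and (Filter.eventually_gt_atTop i)).exists
    exact ⟨n + 1, (hnext n (p n)).2.2.2.2.2 i hin
      (mem_domPre_of_mem_leftCoset (hn (hnext n (p n)).2.2.1))⟩
  have h1g : ∀ n, T.one (T.dom g) ∈ (p n).1.1.1.carrier := fun n => (hM n).choose
  have h1k : ∀ n, T.one (T.dom k) ∈ (p n).1.1.1.carrier := fun n => (hM n).choose_spec.choose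
  have := hX.t0Space
  refine ⟨g, k, ex, ey, ?_, fun U h1 => ?_⟩
  -- Every `U_n` contains the identities at both `dom g` and `dom k`, and the `U_n` enter each
  -- member of `𝒰` around either identity. So the two domains have the same open neighbourhoods.
  · refine (inseparable_iff_forall_isOpen.2 fun O hO => ?_).eq
    have aux : ∀ z, z ∈ O → T.cod ⁻¹' O ∈ 𝓝 (T.one z) := fun z hz =>
      (hO.preimage T.continuous_cod).mem_nhds (by rwa [mem_preimage, T.cod_one])
    constructor
    · intro h
      obtain ⟨V, hV, h1V, hVO⟩ := D.nhds_basis _ _ (aux _ h)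
      obtain ⟨n, hn⟩ := hgU ⟨V, hV⟩ h1V
      have := hVO (hn (h1k n))
      rwa [mem_preimage, T.cod_one] at this
    · intro h
      obtain ⟨V, hV, h1V, hVO⟩ := D.nhds_basis _ _ (aux _ h)
      obtain ⟨n, hn⟩ := hkU ⟨V, hV⟩ h1V
      have := hVO (hn (h1g n))
      rwa [mem_preimage, T.cod_one] at this
  · obtain ⟨S, hS, h1S⟩ : T.one (T.dom g) ∈ ⋃₀ D.𝒮 U := by
      rw [D.sUnion_eq]; exact one_mem_domPre h1
    obtain ⟨V, hV, h1V, hVS⟩ := D.nhds_basis _ _ ((D.isOpen U S hS).mem_nhds h1S)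
    obtain ⟨n, hn⟩ := hgU ⟨V, hV⟩ h1V
    exact (hM n).coarsen hS (hn.trans hVS)

theorem IsCountable.isTopologicalIso_iota (hG : IsQuasiPolish G) (hX : IsQuasiPolish X)
    (hD : D.IsCountable) : (D.iota hT).IsTopologicalIso := by
  have := hG.t0Space
  refine ⟨IsHomeomorph.id, isHomeomorph_iff_isEmbedding_surjective.2
    ⟨⟨D.isInducing_iota hT, (D.isInducing_iota hT).injective⟩, ?_⟩⟩
  rintro ⟨x, y, f⟩
  obtain ⟨g, k, ex, ey, e, h⟩ := exists_matches hG hX hD.1 f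
  exact ⟨_, iota_eq_of_matches e h ex ey⟩

end CosetData

end Groupoid

end EtaleRep

theorem mainTheorem8 {G : Type u} {X : Type v} [TopologicalSpace G] [TopologicalSpace X]
    (T : EtaleRep.TopologicalGroupoid G X) (hG : EtaleRep.IsQuasiPolish G)
    (hX : EtaleRep.IsQuasiPolish X) (hT : T.IsOpenGroupoid) (hna : T.IsNonArchimedean) :
    (∃ D : EtaleRep.CosetData T, D.IsCountable) ∧
    (∀ D : EtaleRep.CosetData T, D.IsCountable →
      D.language.IsCountable ∧ (D.canonicalStructure hT).IsSecondCountable ∧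
        (D.iota hT).IsTopologicalIso) ∧
    ∃ (L : EtaleRep.MultiSortedLanguage.{u}) (M : EtaleRep.EtaleStructure.{u, v, u} L X)
      (F : T.Hom M.isoGroupoid),
      L.IsCountable ∧ M.IsSecondCountable ∧ F.obj = id ∧ F.IsTopologicalIso := by
  have := hG.secondCountableTopology
  have h₂ (D : EtaleRep.CosetData T) : (D.canonicalStructure hT).IsSecondCountable := fun U =>
    EtaleRep.TopologicalGroupoid.secondCountableTopology_coset hT
      (Subtype.val (p := fun U => U ∈ D.𝒰) U)
  obtain ⟨D, hD⟩ := EtaleRep.CosetData.exists_isCountable hT hna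
  exact ⟨⟨D, hD⟩, fun D hD => ⟨hD.language, h₂ D, hD.isTopologicalIso_iota hG hX⟩,
    D.language, D.canonicalStructure hT, D.iota hT, hD.language, h₂ D, rfl,
    hD.isTopologicalIso_iota hG hX⟩
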